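/- Let $\mathbb{D}=\{|z|<1\}$, $\overline{\mathbb{D}}=\{|z|\le 1\}$ and $\mathbb{T}=\{|z|=1\}$ in $\mathbb{C}$. Let $p\in\mathbb{C}[z,w]$ have degree $(n,m)$, that is, degree exactly $n$ in $z$ and exactly $m$ in $w$, and let $\tilde p\in\mathbb{C}[z,w]$ be its reflection, $$\tilde p(z,w)=z^n w^m\,\overline{p(1/\bar z,1/\bar w)}.$$ Suppose that either (a) $p$ has no zeros on $\mathbb{T}\times\overline{\mathbb{D}}$, or (b) $p$ has no zeros on $\mathbb{T}\times\mathbb{D}$ and $p$ and $\tilde p$ have no nonconstant common factor in $\mathbb{C}[z,w]$. Let $n_2$ be the number of zeros of the one-variable polynomial $p(z,0)$ in $\mathbb{D}$, counted with multiplicity. Then $n_2\le n$ and, with $n_1=n-n_2$, there exist polynomials $A_1,\dots,A_m,B_1,\dots,B_{n_1},C_1,\dots,C_{n_2}\in\mathbb{C}[z,w]$ such that for all $(z,w)\in\mathbb{C}^2$ $$|p(z,w)|^2-|\tilde p(z,w)|^2=(1-|w|^2)\sum_{j=1}^{m}|A_j(z,w)|^2+(1-|z|^2)\left(\sum_{j=1}^{n_1}|B_j(z,w)|^2-\sum_{j=1}^{n_2}|C_j(z,w)|^2\right).$$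 -/

import Mathlib

noncomputable section

/-- `p(z, w)` for a polynomial `p ∈ ℂ[z, w]`; variable `0` is `z` and variable `1` is `w`. -/
def evalAt (p : MvPolynomial (Fin 2) ℂ) (z w : ℂ) : ℂ :=
  MvPolynomial.eval ![z, w] p

/-- `p` has degree `(n, m)`: degree exactly `n` in `z` and exactly `m` in `w`. -/
def HasBidegree (p : MvPolynomial (Fin 2) ℂ) (n m : ℕ) : Prop :=
  p.degreeOf 0 = n ∧ p.degreeOf 1 = m

/-- The reflection of `p` at the degree `(n, m)`: the monomial `c z^j w^k` is sent to
`conj c * z^(n-j) w^(m-k)`. For `p` of degree at most `(n, m)` this is the polynomial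
`z^n w^m conj (p (1 / conj z, 1 / conj w))`, see `evalAt_reflection`. -/
def reflection (n m : ℕ) (p : MvPolynomial (Fin 2) ℂ) : MvPolynomial (Fin 2) ℂ :=
  ∑ s ∈ p.support,
    MvPolynomial.C (starRingEnd ℂ (p.coeff s)) *
      (MvPolynomial.X 0 ^ (n - s 0) * MvPolynomial.X 1 ^ (m - s 1))

theorem evalAt_reflection {n m : ℕ} {p : MvPolynomial (Fin 2) ℂ}
    (hn : p.degreeOf 0 ≤ n) (hm : p.degreeOf 1 ≤ m) {z w : ℂ} (hz : z ≠ 0) (hw : w ≠ 0) :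
    evalAt (reflection n m p) z w =
      z ^ n * w ^ m *
        starRingEnd ℂ (evalAt p (1 / starRingEnd ℂ z) (1 / starRingEnd ℂ w)) := by
  have h2 : evalAt p (1 / starRingEnd ℂ z) (1 / starRingEnd ℂ w) =
      ∑ s ∈ p.support, p.coeff s *
        ((1 / starRingEnd ℂ z) ^ s 0 * (1 / starRingEnd ℂ w) ^ s 1) := by
    unfold evalAt
    rw [MvPolynomial.eval_eq']
    simp [Fin.prod_univ_two]
  rw [h2]
  unfold evalAt reflection
  simp only [map_sum, map_mul, map_pow, MvPolynomial.eval_C, MvPolynomial.eval_X,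
    Finset.mul_sum]
  refine Finset.sum_congr rfl fun s hs => ?_
  have h0 : s 0 ≤ n := (MvPolynomial.degreeOf_le_iff.1 hn) s hs
  have h1 : s 1 ≤ m := (MvPolynomial.degreeOf_le_iff.1 hm) s hs
  have hc : ∀ x : ℂ, starRingEnd ℂ (1 / starRingEnd ℂ x) = x⁻¹ := fun x => by simp
  simp only [Matrix.cons_val_zero, Matrix.cons_val_one, hc, inv_pow,
    pow_sub₀ _ hz h0, pow_sub₀ _ hw h1]
  ring

/-- The one-variable polynomial `p(z, 0)`. -/
def sliceAtZero (p : MvPolynomial (Fin 2) ℂ) : Polynomial ℂ :=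
  MvPolynomial.aeval ![Polynomial.X, 0] p

open Classical in
/-- The number of zeros of `q` in the open unit disk, counted with multiplicity. -/
def numDiskZeros (q : Polynomial ℂ) : ℕ :=
  q.roots.countP fun a => ‖a‖ < 1

/-- `p` has no zeros on `𝕋 × closed disk`. -/
def NoZerosCircleClosedDisk (p : MvPolynomial (Fin 2) ℂ) : Prop :=
  ∀ z w : ℂ, ‖z‖ = 1 → ‖w‖ ≤ 1 → evalAt p z w ≠ 0

/-- `p` has no zeros on `𝕋 × open disk`. -/
def NoZerosCircleDisk (p : MvPolynomial (Fin 2) ℂ) : Prop :=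
  ∀ z w : ℂ, ‖z‖ = 1 → ‖w‖ < 1 → evalAt p z w ≠ 0

end

/-!
# Sums of squares for polynomials without zeros on a face of the bidisk

Write `p(z, w) = ∑ k ≤ m, P k (z) w ^ k`, and suppose first that `p` has no zeros with `|z| = 1`,
`|w| ≤ 1`. By Schur–Cohn, for `|z| = 1` the quotient `(|p|² - |p̃|²) / (1 - |w|²)` is a positive
quadratic form in `1, w, …, w ^ (m - 1)`, whose matrix is a Laurent polynomial in `z`
(`schurCohn_pos`, `schurCohn_shift`). The matrix Fejér–Riesz theorem (`exists_corr_eq_of_posDef`)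
writes this matrix as `E(z)ᴴ E(z)` with `E` a matrix polynomial invertible on the closed disk; the
rows of `E` are the polynomials `A j`, and `|p|² + ∑ |w A j|² = |p̃|² + ∑ |A j|²` holds for `|z| =
1` and all `w`. In other words, the matrices `N` with rows `p, w A j` and `M` with rows `p̃, A j`
(coefficients with respect to `w`) satisfy `‖N(z) v‖ = ‖M(z) v‖` on the circle
(`CircleIsometric`).

It follows that `‖N(z) v‖² - ‖M(z) v‖² = (1 - |z|²) Q` for an explicit Hermitian form `Q`, the
difference of the norms of truncations of `N H` and `M H` (`lowDiff`, `sum_sq_norm_eval_sub_eq`),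
and it remains to bound the indices of `Q`. Multiplication by `N` and by `M` have the same norm in
`L²` of the circle, so `Q(H) ≤ 0` as soon as the high part of `M H` can be removed by subtracting
from `H` a vector analytic in the disk (`lowNorm_mulVec_le`). Since `E` is invertible, the only
obstructions are divisibility conditions at the zeros in the disk of the remaining pivot of `M`,
the reflection of `p(z, 0)`; there are `n₁` of them. In the same way `Q ≥ 0` up to `n₂`
conditions, coming from the pivot `p(z, 0)` of `N` (`HasDefect.exists_lowNorm_le`). Diagonalizing
`Q` gives the polynomials `B j` and `C j` (`exists_sum_sq_sub_sum_sq`).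

If `p` has zeros with `|z| = |w| = 1`, the argument applies to `p(z, s w)` for `s < 1`, whose
slice at `w = 0` is the same. The factors `E` are bounded, the positive and negative index of `Q`
can only drop in the limit, and a limit point of the factors as `s → 1` gives the result
(`exists_factor_indexLE`).
-/

open Polynomial Matrix Metric Real Filter Topology
open scoped ComplexConjugate Matrix.Norms.Elementwise ComplexOrder

/-! ### One-variable polynomials on the unit circle -/

/-- The reflection `z ^ n * conj (f (1 / conj z))` of a one-variable polynomial of degree at most
`n`. -/
noncomputable def conjReflect (n : ℕ) (f : ℂ[X]) : ℂ[X] :=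
  (f.map (starRingEnd ℂ)).reflect n

theorem coeff_conjReflect {n : ℕ} (f : ℂ[X]) {k : ℕ} (hk : k ≤ n) :
    (conjReflect n f).coeff k = conj (f.coeff (n - k)) := by
  simp [conjReflect, coeff_reflect, revAt_le hk]

theorem natDegree_conjReflect_le {n : ℕ} {f : ℂ[X]} (hf : f.natDegree ≤ n) :
    (conjReflect n f).natDegree ≤ n := by
  rw [natDegree_le_iff_coeff_eq_zero]
  intro k hk
  rw [conjReflect, coeff_reflect, revAt_eq_self_of_lt hk, coeff_map,
    coeff_eq_zero_of_natDegree_lt (hf.trans_lt hk), map_zero]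

theorem eval_conjReflect {n : ℕ} {f : ℂ[X]} (hf : f.natDegree ≤ n) {z : ℂ} (hz : z ≠ 0) :
    (conjReflect n f).eval z = z ^ n * conj (f.eval (conj z)⁻¹) := by
  rw [eval_eq_sum_range' (Nat.lt_succ_of_le (natDegree_conjReflect_le hf)),
    eval_eq_sum_range' (Nat.lt_succ_of_le hf), map_sum, Finset.mul_sum,
    ← Finset.sum_range_reflect]
  refine Finset.sum_congr rfl fun k hk => ?_
  have hk : k ≤ n := Nat.lt_succ_iff.1 (Finset.mem_range.1 hk)
  have e : n + 1 - 1 - k = n - k := by omega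
  rw [e, coeff_conjReflect f (Nat.sub_le n k), Nat.sub_sub_self hk]
  simp only [map_mul, map_pow, map_inv₀, Complex.conj_conj, inv_pow, pow_sub₀ _ hz hk]
  ring

theorem conj_eq_inv_of_norm_eq_one {z : ℂ} (hz : ‖z‖ = 1) : conj z = z⁻¹ := by
  rw [Complex.inv_def, Complex.normSq_eq_norm_sq, hz]; simp

theorem eval_conjReflect_of_norm_eq_one {n : ℕ} {f : ℂ[X]} (hf : f.natDegree ≤ n) {z : ℂ}
    (hz : ‖z‖ = 1) : (conjReflect n f).eval z = z ^ n * conj (f.eval z) := by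
  have hz0 : z ≠ 0 := norm_ne_zero_iff.1 (by rw [hz]; exact one_ne_zero)
  rw [eval_conjReflect hf hz0, conj_eq_inv_of_norm_eq_one hz, inv_inv]

theorem sum_range_sq_norm_coeff_eq_circleAverage {f : ℂ[X]} {n : ℕ} (hf : f.natDegree ≤ n) :
    ∑ k ∈ Finset.range (n + 1), ‖f.coeff k‖ ^ 2 = circleAverage (fun u => ‖f.eval u‖ ^ 2) 0 1 := by
  rw [← sum_sq_norm_coeff_eq_circleAverage]
  symm
  refine Finset.sum_subset (fun k hk => ?_) fun k _ hk => ?_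
  · exact Finset.mem_range.2 (Nat.lt_succ_of_le ((le_natDegree_of_mem_supp k hk).trans hf))
  · simp [notMem_support_iff.1 hk]

theorem continuousOn_sphere_of_diffContOnCl {s : ℂ → ℂ} (hs : DiffContOnCl ℂ s (ball 0 1)) :
    ContinuousOn s (sphere 0 1) := by
  refine hs.continuousOn.mono ?_
  rw [closure_ball _ one_ne_zero]
  exact sphere_subset_closedBall

/-- The terms of degree at most `n` and the analytic terms of order above `n` are orthogonal in
`L²` of the circle. -/
theorem sum_range_sq_norm_coeff_le_circleAverage {t : ℂ[X]} {n : ℕ} (ht : t.natDegree ≤ n)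
    {s : ℂ → ℂ} (hs : DiffContOnCl ℂ s (ball 0 1)) :
    ∑ k ∈ Finset.range (n + 1), ‖t.coeff k‖ ^ 2 ≤
      circleAverage (fun u => ‖t.eval u + u ^ (n + 1) * s u‖ ^ 2) 0 1 := by
  set g : ℂ → ℂ := fun u => u * ((conjReflect n t).eval u * s u) with hg
  have hgd : DiffContOnCl ℂ g (ball 0 |(1 : ℝ)|) := by
    rw [abs_one]
    have h1 : Differentiable ℂ (fun u : ℂ => u * (conjReflect n t).eval u) := by fun_prop
    simpa only [smul_eq_mul, mul_assoc] using h1.diffContOnCl.smul hs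
  have hsc := continuousOn_sphere_of_diffContOnCl hs
  have hg0 : circleAverage g 0 1 = 0 := by
    rw [hgd.circleAverage]; simp [hg]
  have hgc : CircleIntegrable g 0 1 := by
    refine ContinuousOn.circleIntegrable zero_le_one ?_
    exact continuousOn_sphere_of_diffContOnCl (by simpa using hgd)
  have hre : circleAverage (fun u => (g u).re) 0 1 = 0 := by
    have := Complex.reCLM.circleAverage_comp_comm hgc
    simpa [hg0, Function.comp_def] using this
  have ht2 : CircleIntegrable (fun u => ‖t.eval u‖ ^ 2) 0 1 :=
    ContinuousOn.circleIntegrable zero_le_one (by fun_prop)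
  have hre2 : CircleIntegrable (fun u => 2 * (g u).re) 0 1 := by
    refine ContinuousOn.circleIntegrable zero_le_one ?_
    have := continuousOn_sphere_of_diffContOnCl (s := g) (by simpa using hgd)
    fun_prop
  have key : circleAverage (fun u => ‖t.eval u‖ ^ 2 + 2 * (g u).re) 0 1 =
      ∑ k ∈ Finset.range (n + 1), ‖t.coeff k‖ ^ 2 := by
    rw [circleAverage_fun_add ht2 hre2, ← sum_range_sq_norm_coeff_eq_circleAverage ht]
    have := circleAverage_fun_smul (a := (2 : ℝ)) (f := fun u => (g u).re) (c := 0) (R := 1)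
    simp only [smul_eq_mul, hre, mul_zero] at this
    rw [this, add_zero]
  rw [← key]
  refine circleAverage_mono (ht2.add hre2) ?_ ?_
  · refine ContinuousOn.circleIntegrable zero_le_one ?_
    fun_prop
  · intro u hu
    have hu1 : ‖u‖ = 1 := by simpa using hu
    have hgu : g u = conj (t.eval u) * (u ^ (n + 1) * s u) := by
      simp only [hg, eval_conjReflect_of_norm_eq_one ht hu1]; ring
    have e : ‖t.eval u + u ^ (n + 1) * s u‖ ^ 2 = ‖t.eval u‖ ^ 2 + 2 * (g u).re +
        ‖u ^ (n + 1) * s u‖ ^ 2 := by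
      rw [hgu, ← Complex.normSq_eq_norm_sq, ← Complex.normSq_eq_norm_sq,
        ← Complex.normSq_eq_norm_sq, Complex.normSq_add]
      have : (eval u t * conj (u ^ (n + 1) * s u)).re =
          (conj (eval u t) * (u ^ (n + 1) * s u)).re := by
        simp only [Complex.mul_re, Complex.conj_re, Complex.conj_im]; ring
      rw [this]; ring
    simp only [e]
    have := sq_nonneg ‖u ^ (n + 1) * s u‖
    linarith

/-! ### Truncated norms -/

/-- The square sum of the coefficients of degree at most `n` of a vector of polynomials. -/
noncomputable def lowNorm {ι : Type*} [Fintype ι] (n : ℕ) (f : ι → ℂ[X]) : ℝ :=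
  ∑ i, ∑ k ∈ Finset.range (n + 1), ‖(f i).coeff k‖ ^ 2

/-- Two polynomial matrices with `‖M u v‖ = ‖N u v‖` for all `u` on the unit circle and all
vectors `v`. -/
def CircleIsometric {ι κ : Type*} [Fintype ι] [Fintype κ] (M N : Matrix ι κ ℂ[X]) : Prop :=
  ∀ u : ℂ, ‖u‖ = 1 → ∀ v : κ → ℂ,
    ∑ i, ‖∑ j, (M i j).eval u * v j‖ ^ 2 = ∑ i, ‖∑ j, (N i j).eval u * v j‖ ^ 2

theorem exists_eq_add_X_pow_mul (n : ℕ) (f : ℂ[X]) :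
    ∃ t q : ℂ[X], t.natDegree ≤ n ∧ f = t + X ^ (n + 1) * q ∧
      ∀ k ∈ Finset.range (n + 1), t.coeff k = f.coeff k := by
  have h := modByMonic_add_div f (X ^ (n + 1) : ℂ[X])
  refine ⟨f %ₘ X ^ (n + 1), f /ₘ X ^ (n + 1), ?_, h.symm, fun k hk => ?_⟩
  · have := natDegree_modByMonic_lt f (monic_X_pow (n + 1)) (fun h => by
      have := congrArg natDegree h; simp at this)
    rw [natDegree_X_pow] at this
    omega
  · conv_rhs => rw [← h]
    rw [coeff_add, coeff_X_pow_mul', if_neg, add_zero]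
    have := Finset.mem_range.1 hk
    omega

section

variable {ι κ : Type*}

/-- The vector of polynomials `∑ j ≤ n, u ^ (n - j) h j`. -/
noncomputable def revPoly (n : ℕ) (h : ℕ → κ → ℂ) : κ → ℂ[X] := fun c =>
  ∑ j ∈ Finset.range (n + 1), C (h j c) * X ^ (n - j)

theorem coeff_revPoly {n : ℕ} (h : ℕ → κ → ℂ) (c : κ) {k : ℕ} (hk : k ≤ n) :
    (revPoly n h c).coeff k = h (n - k) c := by
  simp only [revPoly, finsetSum_coeff, coeff_C_mul_X_pow]
  rw [Finset.sum_eq_single (n - k)]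
  · rw [if_pos (by omega)]
  · intro j hj hne
    rw [if_neg]
    have := Finset.mem_range.1 hj
    omega
  · intro h
    exact absurd (Finset.mem_range.2 (by omega)) h
variable [Fintype κ]

theorem coeff_mulVec_revPoly (K : Matrix ι κ ℂ[X]) (n : ℕ) (h : ℕ → κ → ℂ) (i : ι) :
    ((K *ᵥ revPoly n h) i).coeff n =
      ∑ c, ∑ j ∈ Finset.range (n + 1), (K i c).coeff j * h j c := by
  simp only [mulVec, dotProduct, finsetSum_coeff]
  refine Finset.sum_congr rfl fun c _ => ?_
  rw [coeff_mul, Finset.Nat.sum_antidiagonal_eq_sum_range_succ_mk]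
  refine Finset.sum_congr rfl fun j hj => ?_
  have := Finset.mem_range.1 hj
  rw [coeff_revPoly h c (Nat.sub_le n j), Nat.sub_sub_self (by omega)]
variable [Fintype ι] {M N : Matrix ι κ ℂ[X]}

/-- If the part of `M H` of degree above `n` is `u ^ (n + 1) M y` for a vector `y` analytic on the
disk, then replacing `H` by `H - u ^ (n + 1) y` reduces `M H` to its low part, without changing the
low part of `N H`; the isometry on the circle gives the inequality. -/
theorem lowNorm_mulVec_le (hMN : CircleIsometric M N) {n : ℕ} {H : κ → ℂ[X]} {t q : ι → ℂ[X]}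
    (ht : ∀ i, (t i).natDegree ≤ n) (htq : ∀ i, (M *ᵥ H) i = t i + X ^ (n + 1) * q i)
    {d : ℂ[X]} (hd : ∀ u : ℂ, ‖u‖ ≤ 1 → d.eval u ≠ 0) {y : κ → ℂ[X]}
    (hy : ∀ i, (M *ᵥ y) i = d * q i) :
    lowNorm n (N *ᵥ H) ≤ lowNorm n (M *ᵥ H) := by
  choose t' q' ht' htq' hc' using fun i => exists_eq_add_X_pow_mul n ((N *ᵥ H) i)
  have hcoef : ∀ i, ∀ k ∈ Finset.range (n + 1), ((M *ᵥ H) i).coeff k = (t i).coeff k := by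
    intro i k hk
    rw [htq, coeff_add, coeff_X_pow_mul', if_neg, add_zero]
    have := Finset.mem_range.1 hk
    omega
  set s : ι → ℂ → ℂ := fun i u => (q' i).eval u - ((N *ᵥ y) i).eval u / d.eval u with hs
  have hsd : ∀ i, DiffContOnCl ℂ (s i) (ball 0 1) := by
    intro i
    refine DifferentiableOn.diffContOnCl ?_
    rw [closure_ball _ one_ne_zero]
    intro u hu
    have hu : d.eval u ≠ 0 := hd u (by simpa using hu)
    exact (by fun_prop (disch := assumption) : DifferentiableAt ℂ (s i) u).differentiableWithinAt
  have hint : ∀ i, CircleIntegrable (fun u => ‖(t' i).eval u + u ^ (n + 1) * s i u‖ ^ 2) 0 1 := by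
    intro i
    refine ContinuousOn.circleIntegrable zero_le_one ?_
    have := continuousOn_sphere_of_diffContOnCl (hsd i)
    fun_prop
  have hint2 : ∀ i, CircleIntegrable (fun u => ‖(t i).eval u‖ ^ 2) 0 1 := fun i =>
    ContinuousOn.circleIntegrable zero_le_one (by fun_prop)
  calc lowNorm n (N *ᵥ H) = ∑ i, ∑ k ∈ Finset.range (n + 1), ‖(t' i).coeff k‖ ^ 2 := by
        refine Finset.sum_congr rfl fun i _ => Finset.sum_congr rfl fun k hk => ?_
        rw [hc' i k hk]
    _ ≤ ∑ i, circleAverage (fun u => ‖(t' i).eval u + u ^ (n + 1) * s i u‖ ^ 2) 0 1 :=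
        Finset.sum_le_sum fun i _ => sum_range_sq_norm_coeff_le_circleAverage (ht' i) (hsd i)
    _ = ∑ i, circleAverage (fun u => ‖(t i).eval u‖ ^ 2) 0 1 := by
        rw [← circleAverage_fun_sum fun i _ => hint i, ← circleAverage_fun_sum fun i _ => hint2 i]
        refine circleAverage_congr_sphere fun u hu => ?_
        have hu1 : ‖u‖ = 1 := by simpa using hu
        have hdu := hd u hu1.le
        have key := hMN u hu1 fun j => (H j).eval u - u ^ (n + 1) * ((y j).eval u / d.eval u)
        have ev : ∀ (K : Matrix ι κ ℂ[X]) i, ∑ j, (K i j).eval u *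
            ((H j).eval u - u ^ (n + 1) * ((y j).eval u / d.eval u)) =
            ((K *ᵥ H) i).eval u - u ^ (n + 1) * (((K *ᵥ y) i).eval u / d.eval u) := by
          intro K i
          simp only [mulVec, dotProduct, eval_finsetSum, eval_mul, mul_sub,
            Finset.sum_sub_distrib, Finset.sum_div, Finset.mul_sum]
          congr 1
          refine Finset.sum_congr rfl fun j _ => ?_
          ring
        simp only [ev, htq, hy, htq'] at key
        refine (Eq.trans ?_ key.symm).trans ?_
        · refine Finset.sum_congr rfl fun i _ => ?_
          simp only [hs, eval_add, eval_mul, eval_pow, eval_X]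
          congr 2
          ring
        · refine Finset.sum_congr rfl fun i _ => ?_
          simp only [eval_add, eval_mul, eval_pow, eval_X]
          congr 2
          field_simp
          ring
    _ = ∑ i, ∑ k ∈ Finset.range (n + 1), ‖(t i).coeff k‖ ^ 2 :=
        Finset.sum_congr rfl fun i _ => (sum_range_sq_norm_coeff_eq_circleAverage (ht i)).symm
    _ = lowNorm n (M *ᵥ H) := by
        refine Finset.sum_congr rfl fun i _ => Finset.sum_congr rfl fun k hk => ?_
        rw [hcoef i k hk]

theorem CircleIsometric.symm (h : CircleIsometric M N) : CircleIsometric N M :=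
  fun u hu v => (h u hu v).symm

theorem lowNorm_eq_of_natDegree_le (hMN : CircleIsometric M N) {n : ℕ} {H : κ → ℂ[X]}
    (hM : ∀ i, ((M *ᵥ H) i).natDegree ≤ n) (hN : ∀ i, ((N *ᵥ H) i).natDegree ≤ n) :
    lowNorm n (N *ᵥ H) = lowNorm n (M *ᵥ H) := by
  refine le_antisymm
    (lowNorm_mulVec_le hMN (t := M *ᵥ H) (q := 0) hM (by simp) (d := 1) (by simp) (y := 0)
      (by simp))
    (lowNorm_mulVec_le hMN.symm (t := N *ᵥ H) (q := 0) hN (by simp) (d := 1) (by simp) (y := 0)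
      (by simp))

/-- The difference of the truncated square norms of `N H` and `M H`. -/
noncomputable def lowDiff (n : ℕ) (M N : Matrix ι κ ℂ[X]) (H : κ → ℂ[X]) : ℝ :=
  lowNorm n (N *ᵥ H) - lowNorm n (M *ᵥ H)

theorem lowNorm_congr {n : ℕ} {f g : ι → ℂ[X]}
    (h : ∀ i, ∀ k ≤ n, (f i).coeff k = (g i).coeff k) : lowNorm n f = lowNorm n g := by
  refine Finset.sum_congr rfl fun i _ => Finset.sum_congr rfl fun k hk => ?_
  rw [h i k (Nat.lt_succ_iff.1 (Finset.mem_range.1 hk))]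

theorem lowNorm_eq_lowNorm_sub {n R : ℕ} (hnR : n ≤ R) (f : ι → ℂ[X]) :
    lowNorm n f = lowNorm R f - ∑ i, ∑ k ∈ Finset.Ico (n + 1) (R + 1), ‖(f i).coeff k‖ ^ 2 := by
  rw [eq_sub_iff_add_eq, lowNorm, lowNorm, ← Finset.sum_add_distrib]
  exact Finset.sum_congr rfl fun i _ =>
    Finset.sum_range_add_sum_Ico _ (Nat.succ_le_succ hnR)

theorem exists_natDegree_le (f : ι → ℂ[X]) : ∃ R, ∀ i, (f i).natDegree ≤ R :=
  ⟨Finset.univ.sup fun i => (f i).natDegree, fun i =>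
    Finset.le_sup (f := fun i => (f i).natDegree) (Finset.mem_univ i)⟩

/-- The total norms of `M H` and `N H` agree, and constants in `H` only affect the low parts. -/
theorem lowDiff_add_C (hMN : CircleIsometric M N) {n : ℕ} (hM : ∀ i j, (M i j).natDegree ≤ n)
    (hN : ∀ i j, (N i j).natDegree ≤ n) (H : κ → ℂ[X]) (v : κ → ℂ) :
    lowDiff n M N (fun j => H j + C (v j)) = lowDiff n M N H := by
  have hcoef : ∀ K : Matrix ι κ ℂ[X], (∀ i j, (K i j).natDegree ≤ n) → ∀ i, ∀ k, n < k →
      ((K *ᵥ fun j => H j + C (v j)) i).coeff k = ((K *ᵥ H) i).coeff k := by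
    intro K hK i k hk
    simp only [mulVec, dotProduct, finsetSum_coeff, mul_add, coeff_add, coeff_mul_C]
    refine Finset.sum_congr rfl fun j _ => ?_
    rw [coeff_eq_zero_of_natDegree_lt ((hK i j).trans_lt hk), zero_mul, add_zero]
  set H' : κ → ℂ[X] := fun j => H j + C (v j) with hH'
  -- At a degree `R` above all those involved the two norms agree, so the form equals the difference
  -- of the high parts, which constants do not affect.
  obtain ⟨R₁, h₁⟩ := exists_natDegree_le (M *ᵥ H)
  obtain ⟨R₂, h₂⟩ := exists_natDegree_le (N *ᵥ H)
  obtain ⟨R₃, h₃⟩ := exists_natDegree_le (M *ᵥ H')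
  obtain ⟨R₄, h₄⟩ := exists_natDegree_le (N *ᵥ H')
  obtain ⟨R, hn, r₁, r₂, r₃, r₄⟩ :
      ∃ R, n ≤ R ∧ R₁ ≤ R ∧ R₂ ≤ R ∧ R₃ ≤ R ∧ R₄ ≤ R :=
    ⟨n + R₁ + R₂ + R₃ + R₄, by omega, by omega, by omega, by omega, by omega⟩
  have e := lowNorm_eq_of_natDegree_le hMN (fun i => (h₁ i).trans r₁) fun i => (h₂ i).trans r₂
  have e' := lowNorm_eq_of_natDegree_le hMN (fun i => (h₃ i).trans r₃) fun i => (h₄ i).trans r₄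
  have hIco : ∀ K : Matrix ι κ ℂ[X], (∀ i j, (K i j).natDegree ≤ n) →
      ∑ i, ∑ k ∈ Finset.Ico (n + 1) (R + 1), ‖((K *ᵥ H') i).coeff k‖ ^ 2 =
        ∑ i, ∑ k ∈ Finset.Ico (n + 1) (R + 1), ‖((K *ᵥ H) i).coeff k‖ ^ 2 := by
    intro K hK
    refine Finset.sum_congr rfl fun i _ => Finset.sum_congr rfl fun k hk => ?_
    rw [hcoef K hK i k (Finset.mem_Ico.1 hk).1]
  simp only [lowDiff, lowNorm_eq_lowNorm_sub hn, e, e', hIco M hM, hIco N hN]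
  ring

theorem lowNorm_X_mul (n : ℕ) (f : ι → ℂ[X]) :
    lowNorm n f = lowNorm n (fun i => X * f i) + ∑ i, ‖(f i).coeff n‖ ^ 2 := by
  rw [lowNorm, lowNorm, ← Finset.sum_add_distrib]
  refine Finset.sum_congr rfl fun i _ => ?_
  rw [Finset.sum_range_succ, Finset.sum_range_succ' _ n]
  simp

/-- Shifting the sequence `h` multiplies `revPoly n h` by `u`, up to a constant and to terms of
degree above `n`, neither of which affects the form. -/
theorem sum_sq_norm_sub_eq_lowDiff_sub (hMN : CircleIsometric M N) {n : ℕ}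
    (hM : ∀ i j, (M i j).natDegree ≤ n) (hN : ∀ i j, (N i j).natDegree ≤ n) (h : ℕ → κ → ℂ) :
    ∑ i, ‖∑ c, ∑ j ∈ Finset.range (n + 1), (N i c).coeff j * h j c‖ ^ 2 -
      ∑ i, ‖∑ c, ∑ j ∈ Finset.range (n + 1), (M i c).coeff j * h j c‖ ^ 2 =
    lowDiff n M N (revPoly n h) - lowDiff n M N (revPoly n fun j => h (j + 1)) := by
  have hX : ∀ c, X * revPoly n h c + C (h (n + 1) c) =
      revPoly n (fun j => h (j + 1)) c + X ^ (n + 1) * C (h 0 c) := by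
    intro c
    simp only [revPoly]
    rw [Finset.sum_range_succ', Finset.sum_range_succ _ n, mul_add, Finset.mul_sum]
    have : ∀ j ∈ Finset.range n, X * (C (h (j + 1) c) * X ^ (n - (j + 1))) =
        C (h (j + 1) c) * X ^ (n - j) := by
      intro j hj
      have := Finset.mem_range.1 hj
      rw [show n - j = (n - (j + 1)) + 1 by omega, pow_succ]
      ring
    rw [Finset.sum_congr rfl this]
    simp only [Nat.sub_self, Nat.sub_zero, pow_zero]
    ring
  have e1 : lowDiff n M N (revPoly n fun j => h (j + 1)) =
      lowDiff n M N (fun c => X * revPoly n h c) := by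
    rw [← lowDiff_add_C hMN hM hN (fun c => X * revPoly n h c) (h (n + 1))]
    simp only [hX, lowDiff]
    have : ∀ K : Matrix ι κ ℂ[X], lowNorm n (K *ᵥ revPoly n fun j => h (j + 1)) =
        lowNorm n (K *ᵥ fun c => revPoly n (fun j => h (j + 1)) c + X ^ (n + 1) * C (h 0 c)) := by
      intro K
      refine lowNorm_congr fun i k hk => ?_
      simp only [mulVec, dotProduct, finsetSum_coeff, mul_add, coeff_add]
      refine Finset.sum_congr rfl fun c _ => ?_
      rw [mul_left_comm, coeff_X_pow_mul', if_neg (by omega), add_zero]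
    rw [this M, this N]
  have e2 : ∀ K : Matrix ι κ ℂ[X], (K *ᵥ fun c => X * revPoly n h c) =
      fun i => X * (K *ᵥ revPoly n h) i := by
    intro K
    ext1 i
    simp only [mulVec, dotProduct, Finset.mul_sum]
    exact Finset.sum_congr rfl fun c _ => by ring
  rw [e1]
  simp only [lowDiff, e2, lowNorm_X_mul n (N *ᵥ revPoly n h), lowNorm_X_mul n (M *ᵥ revPoly n h),
    coeff_mulVec_revPoly]
  ring

end

/-! ### The Schur–Cohn form -/

theorem circleIsometric_of_norm_eq {f g : ℂ[X]} (h : ∀ u : ℂ, ‖u‖ = 1 → ‖f.eval u‖ = ‖g.eval u‖) :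
    CircleIsometric (ι := Unit) (κ := Unit) (fun _ _ => f) fun _ _ => g := by
  intro u hu v
  simp [h u hu]

/-- The Schur–Cohn form of a polynomial without zeros in the closed disk is nonnegative. -/
theorem lowDiff_nonneg_of_norm_eq {f g : ℂ[X]} (h : ∀ u : ℂ, ‖u‖ = 1 → ‖f.eval u‖ = ‖g.eval u‖)
    (hg : ∀ u : ℂ, ‖u‖ ≤ 1 → g.eval u ≠ 0) (n : ℕ) (H : Unit → ℂ[X]) :
    0 ≤ lowDiff n (fun _ _ => f : Matrix Unit Unit ℂ[X]) (fun _ _ => g) H := by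
  obtain ⟨t, q, ht, htq, -⟩ := exists_eq_add_X_pow_mul n (g * H ())
  refine sub_nonneg.2 (lowNorm_mulVec_le (circleIsometric_of_norm_eq h).symm (t := fun _ => t)
    (q := fun _ => q) (fun _ => ht) (fun _ => ?_) hg (y := fun _ => q) fun _ => ?_)
  · simpa [mulVec, dotProduct] using htq
  · simp [mulVec, dotProduct]

theorem exists_pos_le_norm_eval {g : ℂ[X]} (hg : ∀ u : ℂ, ‖u‖ ≤ 1 → g.eval u ≠ 0) :
    ∃ δ : ℝ, 0 < δ ∧ ∀ u : ℂ, ‖u‖ ≤ 1 → δ ≤ ‖g.eval u‖ := by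
  obtain ⟨x, hx, hmin⟩ := (isCompact_closedBall (0 : ℂ) 1).exists_isMinOn
    ⟨0, by simp⟩ (f := fun u => ‖g.eval u‖) (by fun_prop)
  refine ⟨‖g.eval x‖, norm_pos_iff.2 (hg x (by simpa using hx)), fun u hu => ?_⟩
  exact hmin (by simpa using hu)

/-- The Schur–Cohn form of a polynomial `g` without zeros in the closed disk is definite: the form
stays positive under the perturbations `g ± s w ^ m`, whose second-order term is negative. -/
theorem coeff_eq_zero_of_lowDiff_nonpos {g : ℂ[X]} {m : ℕ} (hgm : g.natDegree ≤ m)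
    (hg : ∀ u : ℂ, ‖u‖ ≤ 1 → g.eval u ≠ 0) {H : Unit → ℂ[X]} (hH : (H ()).coeff 0 = 0)
    (h : lowDiff m (fun _ _ => conjReflect m g : Matrix Unit Unit ℂ[X]) (fun _ _ => g) H ≤ 0)
    {k : ℕ} (hk : k ≤ m) : (H ()).coeff k = 0 := by
  obtain ⟨δ, hδ, hle⟩ := exists_pos_le_norm_eval hg
  set f := conjReflect m g with hf
  -- The term `s w ^ m` in `g` becomes the constant `s` in the reflection.
  have hpert : ∀ s : ℝ, |s| < δ →
      0 ≤ lowDiff m (fun _ _ => f + C (s : ℂ) : Matrix Unit Unit ℂ[X])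
        (fun _ _ => g + C (s : ℂ) * X ^ m) H := by
    intro s hs
    refine lowDiff_nonneg_of_norm_eq (fun u hu => ?_) (fun u hu h0 => ?_) m H
    · have e : (f + C (s : ℂ)).eval u = u ^ m * conj ((g + C (s : ℂ) * X ^ m).eval u) := by
        have h1 : u * conj u = 1 := by rw [Complex.mul_conj, Complex.normSq_eq_norm_sq, hu]; simp
        have h2 : u ^ m * conj u ^ m = 1 := by rw [← mul_pow, h1, one_pow]
        simp only [hf, eval_add, eval_conjReflect_of_norm_eq_one hgm hu, eval_C, eval_mul, eval_pow,
          eval_X, map_add, map_mul, map_pow, Complex.conj_ofReal]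
        linear_combination -(s : ℂ) * h2
      rw [e, norm_mul, norm_pow, hu, one_pow, one_mul, Complex.norm_conj]
    · simp only [eval_add, eval_mul, eval_C, eval_pow, eval_X] at h0
      have h1 : ‖g.eval u‖ = ‖(s : ℂ) * u ^ m‖ := by
        rw [eq_neg_of_add_eq_zero_left h0, norm_neg]
      rw [norm_mul, norm_pow, Complex.norm_real, Real.norm_eq_abs] at h1
      have h2 : |s| * ‖u‖ ^ m ≤ |s| :=
        mul_le_of_le_one_right (abs_nonneg _) (pow_le_one₀ (norm_nonneg _) hu)
      linarith [hle u hu]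
  set ℓ : ℝ := ∑ k ∈ Finset.range (m + 1), 2 * ((f * H ()).coeff k * conj ((H ()).coeff k)).re
  set S : ℝ := ∑ k ∈ Finset.range (m + 1), ‖(H ()).coeff k‖ ^ 2 with hS
  have hexp : ∀ s : ℝ, lowDiff m (fun _ _ => f + C (s : ℂ) : Matrix Unit Unit ℂ[X])
        (fun _ _ => g + C (s : ℂ) * X ^ m) H =
      lowDiff m (fun _ _ => f : Matrix Unit Unit ℂ[X]) (fun _ _ => g) H - s * ℓ - s ^ 2 * S := by
    intro s
    have e1 : lowNorm m ((fun _ _ => g + C (s : ℂ) * X ^ m : Matrix Unit Unit ℂ[X]) *ᵥ H) =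
        lowNorm m ((fun _ _ => g : Matrix Unit Unit ℂ[X]) *ᵥ H) := by
      refine lowNorm_congr fun _ k hk => ?_
      simp only [mulVec, dotProduct, Finset.univ_unique, Finset.sum_singleton, add_mul, coeff_add,
        mul_assoc, coeff_C_mul, coeff_X_pow_mul']
      split_ifs with hmk
      · obtain rfl : m = k := le_antisymm hmk hk
        simp only [PUnit.default_eq_unit, Nat.sub_self, hH, mul_zero, add_zero]
      · simp
    have e2 : lowNorm m ((fun _ _ => f + C (s : ℂ) : Matrix Unit Unit ℂ[X]) *ᵥ H) =
        lowNorm m ((fun _ _ => f : Matrix Unit Unit ℂ[X]) *ᵥ H) + s * ℓ + s ^ 2 * S := by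
      simp only [lowNorm, mulVec, dotProduct, Finset.univ_unique, Finset.sum_singleton, ℓ, hS,
        Finset.mul_sum, ← Finset.sum_add_distrib]
      refine Finset.sum_congr rfl fun k _ => ?_
      simp only [PUnit.default_eq_unit, add_mul, coeff_add, coeff_C_mul]
      rw [← Complex.normSq_eq_norm_sq, ← Complex.normSq_eq_norm_sq,
        ← Complex.normSq_eq_norm_sq, Complex.normSq_add, Complex.normSq_mul, Complex.normSq_ofReal]
      simp only [map_mul, Complex.conj_ofReal, Complex.mul_re, Complex.mul_im, Complex.conj_re,
        Complex.conj_im, Complex.ofReal_re, Complex.ofReal_im]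
      ring
    simp only [lowDiff, e1, e2]
    ring
  have h1 := hpert (δ / 2) (by rw [abs_of_pos (half_pos hδ)]; exact half_lt_self hδ)
  have h2 := hpert (-(δ / 2)) (by rw [abs_neg, abs_of_pos (half_pos hδ)]; exact half_lt_self hδ)
  rw [hexp] at h1 h2
  have hδ2 : 0 < (δ / 2) ^ 2 := by positivity
  have hS0 : S ≤ 0 := by
    by_contra hpos
    have := mul_pos hδ2 (not_le.1 hpos)
    nlinarith
  have hz := (Finset.sum_eq_zero_iff_of_nonneg fun k _ => sq_nonneg ‖(H ()).coeff k‖).1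
    (le_antisymm hS0 (Finset.sum_nonneg fun k _ => sq_nonneg _)) k
    (Finset.mem_range.2 (Nat.lt_succ_of_le hk))
  exact norm_eq_zero.1 (pow_eq_zero_iff two_ne_zero |>.1 hz)

/-- The matrix of the map taking `v` to the coefficients of degree at most `m` of
`(∑ k, a k u ^ k) * (∑ j < m, v j u ^ (m - j))`. -/
def toeplitz {R : Type*} [Zero R] (m : ℕ) (a : ℕ → R) : Matrix (Fin (m + 1)) (Fin m) R :=
  fun l j => if m ≤ (l : ℕ) + j then a (l + j - m) else 0

/-- A vector with entries `0, …, m - 1`, extended by zero. -/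
def extendZero {m : ℕ} (v : Fin m → ℂ) : ℕ → Unit → ℂ :=
  fun j _ => if h : j < m then v ⟨j, h⟩ else 0

theorem coeff_mul_revPoly_extendZero {m : ℕ} (g : ℂ[X]) (v : Fin m → ℂ) (l : Fin (m + 1)) :
    (g * revPoly m (extendZero v) ()).coeff l = (toeplitz m g.coeff *ᵥ v) l := by
  rw [revPoly, Finset.sum_range_succ, show extendZero v m () = 0 by simp [extendZero], C_0,
    zero_mul, add_zero, ← Fin.sum_univ_eq_sum_range (fun j => C (extendZero v j ()) * X ^ (m - j)),
    Finset.mul_sum, finsetSum_coeff]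
  refine Finset.sum_congr rfl fun j _ => ?_
  change _ = (if m ≤ (l : ℕ) + j then g.coeff (l + j - m) else 0) * v j
  rw [mul_left_comm, coeff_C_mul, coeff_mul_X_pow', extendZero, dif_pos j.2]
  have := j.2
  split_ifs with h1 h2 h2
  · rw [show (l : ℕ) - (m - j) = l + j - m by omega, mul_comm]
  · omega
  · omega
  · simp

theorem lowDiff_revPoly_extendZero (m : ℕ) (f g : ℂ[X]) (v : Fin m → ℂ) :
    lowDiff m (fun _ _ => f : Matrix Unit Unit ℂ[X]) (fun _ _ => g) (revPoly m (extendZero v)) =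
      ∑ l, ‖(toeplitz m g.coeff *ᵥ v) l‖ ^ 2 - ∑ l, ‖(toeplitz m f.coeff *ᵥ v) l‖ ^ 2 := by
  simp only [lowDiff, lowNorm, ← coeff_mul_revPoly_extendZero,
    Finset.univ_unique, Finset.sum_singleton]
  simp only [Finset.sum_range, mulVec, dotProduct, Finset.univ_unique, Finset.sum_singleton,
    PUnit.default_eq_unit]

theorem schurCohn_pos {g : ℂ[X]} {m : ℕ} (hgm : g.natDegree ≤ m)
    (hg : ∀ u : ℂ, ‖u‖ ≤ 1 → g.eval u ≠ 0) {v : Fin m → ℂ} (hv : v ≠ 0) :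
    ∑ l, ‖(toeplitz m (conjReflect m g).coeff *ᵥ v) l‖ ^ 2 <
      ∑ l, ‖(toeplitz m g.coeff *ᵥ v) l‖ ^ 2 := by
  rw [← sub_pos, ← lowDiff_revPoly_extendZero]
  by_contra hle
  refine hv (funext fun j => ?_)
  have := coeff_eq_zero_of_lowDiff_nonpos hgm hg (H := revPoly m (extendZero v))
    (by rw [coeff_revPoly _ _ (Nat.zero_le m)]; simp [extendZero]) (not_lt.1 hle)
    (Nat.sub_le m j)
  rw [coeff_revPoly _ _ (Nat.sub_le m j), Nat.sub_sub_self j.2.le, extendZero, dif_pos j.2] at this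
  exact this

/-- The Christoffel–Darboux identity behind the Schur–Cohn form. -/
theorem schurCohn_shift {g : ℂ[X]} {m : ℕ} (hgm : g.natDegree ≤ m) (v : Fin (m + 1) → ℂ) :
    ‖∑ k : Fin (m + 1), g.coeff k * v k‖ ^ 2 -
        ‖∑ k : Fin (m + 1), (conjReflect m g).coeff k * v k‖ ^ 2 =
      (∑ l, ‖(toeplitz m g.coeff *ᵥ fun j => v j.castSucc) l‖ ^ 2 -
        ∑ l, ‖(toeplitz m (conjReflect m g).coeff *ᵥ fun j => v j.castSucc) l‖ ^ 2) -
      (∑ l, ‖(toeplitz m g.coeff *ᵥ fun j => v j.succ) l‖ ^ 2 -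
        ∑ l, ‖(toeplitz m (conjReflect m g).coeff *ᵥ fun j => v j.succ) l‖ ^ 2) := by
  set f := conjReflect m g with hf
  have hfm : f.natDegree ≤ m := natDegree_conjReflect_le hgm
  have hiso : CircleIsometric (fun _ _ => f : Matrix Unit Unit ℂ[X]) fun _ _ => g :=
    circleIsometric_of_norm_eq fun u hu => by
      rw [hf, eval_conjReflect_of_norm_eq_one hgm hu, norm_mul, norm_pow, hu, one_pow, one_mul,
        Complex.norm_conj]
  have key := sum_sq_norm_sub_eq_lowDiff_sub hiso (fun _ _ => hfm) (fun _ _ => hgm)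
    (extendZero v)
  have e0 : ∀ a : ℂ[X], ∑ j ∈ Finset.range (m + 1), a.coeff j * extendZero v j () =
      ∑ k : Fin (m + 1), a.coeff k * v k := by
    intro a
    rw [Finset.sum_range]
    exact Finset.sum_congr rfl fun k _ => by rw [extendZero, dif_pos k.2]
  have e1 : revPoly m (fun j => extendZero v (j + 1)) =
      revPoly m (extendZero fun j => v j.succ) := by
    ext1 c
    refine Finset.sum_congr rfl fun j hj => ?_
    simp only [extendZero, Nat.add_lt_add_iff_right]
    rfl
  have e2 : revPoly m (extendZero v) = fun c =>
      revPoly m (extendZero fun j => v j.castSucc) c + C (v (Fin.last m)) := by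
    ext1 c
    simp only [revPoly, Finset.sum_range_succ _ m, Nat.sub_self, pow_zero, mul_one]
    have h1 : extendZero v m c = v (Fin.last m) := by simp [extendZero, Fin.last]
    have h2 : extendZero (fun j : Fin m => v j.castSucc) m c = 0 := by simp [extendZero]
    rw [h1, h2, C_0, add_zero]
    congr 1
    refine Finset.sum_congr rfl fun j hj => ?_
    have hj := Finset.mem_range.1 hj
    simp only [extendZero, dif_pos hj, dif_pos (Nat.lt_succ_of_lt hj)]
    rfl
  simp only [Finset.univ_unique, Finset.sum_singleton, PUnit.default_eq_unit, e0] at key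
  rw [key, e1, e2, lowDiff_add_C hiso (fun _ _ => hfm) (fun _ _ => hgm) _ fun _ => v (Fin.last m),
    lowDiff_revPoly_extendZero, lowDiff_revPoly_extendZero]

/-! ### Matrix Laurent polynomials -/

section Laurent

variable {n : ℕ} {ρ μ : Type*} [Fintype ρ]

/-- The matrix polynomial with coefficients `a`, evaluated at `z`. -/
noncomputable def evalCoeffs (a : Fin (n + 1) → Matrix ρ μ ℂ) (z : ℂ) : Matrix ρ μ ℂ :=
  ∑ i : Fin (n + 1), z ^ (i : ℕ) • a i

/-- The coefficients of nonnegative index of the Laurent polynomial `a(z)ᴴ * b(z)`, `‖z‖ = 1`. -/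
noncomputable def corr (a b : Fin (n + 1) → Matrix ρ μ ℂ) : Fin (n + 1) → Matrix μ μ ℂ := fun k =>
  ∑ i : Fin (n + 1), ∑ j : Fin (n + 1), if (i : ℕ) + k = j then (a i)ᴴ * b j else 0

/-- The Laurent polynomial with coefficients `S k` at `z ^ k` for `k ≥ 0` and `(T k)ᴴ` at
`z ^ (-k)` for `k > 0`; the latter power is written as `conj z ^ k`. -/
noncomputable def laurent (S T : Fin (n + 1) → Matrix μ μ ℂ) (z : ℂ) : Matrix μ μ ℂ :=
  ∑ k : Fin (n + 1), (z ^ (k : ℕ) • S k + if k = 0 then 0 else conj z ^ (k : ℕ) • (T k)ᴴ)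

theorem laurent_add (S T S' T' : Fin (n + 1) → Matrix μ μ ℂ) (z : ℂ) :
    laurent (S + S') (T + T') z = laurent S T z + laurent S' T' z := by
  simp only [laurent, ← Finset.sum_add_distrib]
  refine Finset.sum_congr rfl fun k _ => ?_
  split_ifs <;> simp only [Pi.add_apply, smul_add, conjTranspose_add, add_zero]
  abel

theorem laurent_smul (c : ℝ) (S T : Fin (n + 1) → Matrix μ μ ℂ) (z : ℂ) :
    laurent (c • S) (c • T) z = c • laurent S T z := by
  simp only [laurent, Finset.smul_sum]
  refine Finset.sum_congr rfl fun k _ => ?_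
  split_ifs
  · simp only [Pi.smul_apply, add_zero]
    rw [smul_comm]
  · simp only [Pi.smul_apply, smul_add, conjTranspose_smul, star_trivial]
    rw [smul_comm c, smul_comm c]

theorem laurent_sub (S T S' T' : Fin (n + 1) → Matrix μ μ ℂ) (z : ℂ) :
    laurent (S - S') (T - T') z = laurent S T z - laurent S' T' z := by
  rw [eq_sub_iff_add_eq, ← laurent_add, sub_add_cancel, sub_add_cancel]

theorem conjTranspose_evalCoeffs_mul (a b : Fin (n + 1) → Matrix ρ μ ℂ) {z : ℂ} (hz : ‖z‖ = 1) :
    (evalCoeffs a z)ᴴ * evalCoeffs b z = laurent (corr a b) (corr b a) z := by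
  have hzz : conj z * z = 1 := by
    rw [mul_comm, Complex.mul_conj, Complex.normSq_eq_norm_sq, hz]; simp
  have hL : (evalCoeffs a z)ᴴ * evalCoeffs b z =
      ∑ i : Fin (n + 1), ∑ j : Fin (n + 1), (conj z ^ (i : ℕ) * z ^ (j : ℕ)) • ((a i)ᴴ * b j) := by
    simp only [evalCoeffs, conjTranspose_sum, conjTranspose_smul, Matrix.sum_mul, Matrix.mul_sum,
      smul_mul, Matrix.mul_smul, smul_smul, Finset.smul_sum, star_pow]
    rw [Finset.sum_comm]
    refine Finset.sum_congr rfl fun i _ => Finset.sum_congr rfl fun j _ => ?_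
    rw [mul_comm]
    rfl
  have hR : laurent (corr a b) (corr b a) z =
      ∑ i : Fin (n + 1), ∑ j : Fin (n + 1), ∑ k : Fin (n + 1),
      ((if (i : ℕ) + k = j then z ^ (k : ℕ) • ((a i)ᴴ * b j) else 0) +
        if k = 0 then 0 else if (j : ℕ) + k = i then conj z ^ (k : ℕ) • ((a i)ᴴ * b j) else 0) := by
    simp only [laurent, corr, Finset.smul_sum, conjTranspose_sum, Finset.sum_add_distrib]
    congr 1
    · rw [Finset.sum_comm]
      refine Finset.sum_congr rfl fun i _ => ?_
      rw [Finset.sum_comm]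
      refine Finset.sum_congr rfl fun j _ => Finset.sum_congr rfl fun k _ => ?_
      split_ifs <;> simp
    · rw [Finset.sum_congr rfl fun i _ => Finset.sum_comm, Finset.sum_comm]
      refine Finset.sum_congr rfl fun k _ => ?_
      split_ifs with h0
      · simp
      · rw [Finset.sum_comm]
        refine Finset.sum_congr rfl fun i _ => Finset.sum_congr rfl fun j _ => ?_
        split_ifs <;> simp [conjTranspose_mul]
  rw [hL, hR]
  refine Finset.sum_congr rfl fun i _ => Finset.sum_congr rfl fun j _ => ?_
  rcases le_or_gt (i : ℕ) j with hij | hij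
  · have hk : (j : ℕ) - i < n + 1 := by omega
    rw [Finset.sum_eq_single (⟨(j : ℕ) - i, hk⟩ : Fin (n + 1))]
    · rw [if_pos (by simp only; omega)]
      have : (if (⟨(j : ℕ) - i, hk⟩ : Fin (n + 1)) = 0 then (0 : Matrix μ μ ℂ) else
          if (j : ℕ) + (⟨(j : ℕ) - i, hk⟩ : Fin (n + 1)) = i then
            conj z ^ ((⟨(j : ℕ) - i, hk⟩ : Fin (n + 1)) : ℕ) • ((a i)ᴴ * b j) else 0) = 0 := by
        split_ifs with h0 h1
        · rfl
        · exfalso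
          simp only at h1
          apply h0
          ext
          simp only [Fin.val_zero]
          omega
        · rfl
      rw [this, add_zero]
      congr 1
      calc conj z ^ (i : ℕ) * z ^ (j : ℕ) = (conj z * z) ^ (i : ℕ) * z ^ ((j : ℕ) - i) := by
            rw [mul_pow, mul_assoc, ← pow_add, Nat.add_sub_cancel' hij]
        _ = z ^ ((j : ℕ) - i) := by rw [hzz, one_pow, one_mul]
    · intro k _ hk'
      have h1 : (i : ℕ) + k ≠ j := fun h => hk' (by ext; simp only; omega)
      rw [if_neg h1, zero_add]
      split_ifs with h0 h2
      · rfl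
      · exfalso
        apply h0
        ext
        simp only [Fin.val_zero]
        omega
      · rfl
    · simp
  · have hk : (i : ℕ) - j < n + 1 := by omega
    rw [Finset.sum_eq_single (⟨(i : ℕ) - j, hk⟩ : Fin (n + 1))]
    · rw [if_neg (by simp only; omega), zero_add, if_neg, if_pos (by simp only; omega)]
      · congr 1
        calc conj z ^ (i : ℕ) * z ^ (j : ℕ) = (conj z * z) ^ (j : ℕ) * conj z ^ ((i : ℕ) - j) := by
              rw [mul_pow, mul_right_comm, ← pow_add, Nat.add_sub_cancel' hij.le]
          _ = conj z ^ ((i : ℕ) - j) := by rw [hzz, one_pow, one_mul]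
      · intro h0
        have := congrArg Fin.val h0
        simp only [Fin.val_zero] at this
        omega
    · intro k _ hk'
      rw [if_neg (by omega), zero_add]
      split_ifs with h0 h2
      · rfl
      · exact absurd (by ext; simp only; omega) hk'
      · rfl
    · simp

theorem corr_zero (a b : Fin (n + 1) → Matrix ρ μ ℂ) : corr a b 0 = ∑ i, (a i)ᴴ * b i := by
  refine Finset.sum_congr rfl fun i _ => ?_
  simp [Fin.val_inj]

theorem isHermitian_corr_zero (a : Fin (n + 1) → Matrix ρ μ ℂ) : (corr a a 0).IsHermitian := by
  simp [IsHermitian, corr_zero, conjTranspose_sum, conjTranspose_mul]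

theorem trace_corr_zero [Fintype μ] (a : Fin (n + 1) → Matrix ρ μ ℂ) :
    (corr a a 0).trace = ((∑ k, ∑ i, ∑ j, ‖a k i j‖ ^ 2 : ℝ) : ℂ) := by
  rw [corr_zero, trace_sum, Complex.ofReal_sum]
  refine Finset.sum_congr rfl fun k _ => ?_
  simp only [Matrix.trace, diag_apply, mul_apply, conjTranspose_apply]
  rw [Finset.sum_comm, Complex.ofReal_sum]
  refine Finset.sum_congr rfl fun i _ => ?_
  rw [Complex.ofReal_sum]
  refine Finset.sum_congr rfl fun j _ => ?_
  rw [RCLike.star_def, mul_comm, Complex.mul_conj, Complex.normSq_eq_norm_sq]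

end Laurent

/-! ### Matrix Fejér–Riesz factorization -/

section toPoly

variable {n : ℕ} {ρ μ : Type*}

/-- The matrix of polynomials with matrix coefficients `a`. -/
noncomputable def toPoly (a : Fin (n + 1) → Matrix ρ μ ℂ) : Matrix ρ μ ℂ[X] :=
  fun i j => ∑ k : Fin (n + 1), C (a k i j) * X ^ (k : ℕ)

theorem eval_toPoly (a : Fin (n + 1) → Matrix ρ μ ℂ) (i : ρ) (j : μ) (z : ℂ) :
    (toPoly a i j).eval z = evalCoeffs a z i j := by
  simp only [toPoly, eval_finsetSum, eval_mul, eval_C, eval_pow, eval_X, evalCoeffs,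
    Matrix.sum_apply, Matrix.smul_apply, smul_eq_mul]
  exact Finset.sum_congr rfl fun k _ => mul_comm _ _

theorem coeff_toPoly (a : Fin (n + 1) → Matrix ρ μ ℂ) (i : ρ) (j : μ) (k : ℕ) :
    (toPoly a i j).coeff k = if h : k < n + 1 then a ⟨k, h⟩ i j else 0 := by
  simp only [toPoly, finsetSum_coeff, coeff_C_mul_X_pow]
  split_ifs with h
  · rw [Finset.sum_eq_single ⟨k, h⟩]
    · simp
    · intro l _ hl
      rw [if_neg]
      intro hk
      exact hl (by ext; exact hk.symm)
    · simp
  · refine Finset.sum_eq_zero fun l _ => if_neg ?_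
    have := l.2
    omega

theorem natDegree_toPoly_le (a : Fin (n + 1) → Matrix ρ μ ℂ) (i : ρ) (j : μ) :
    (toPoly a i j).natDegree ≤ n := by
  rw [natDegree_le_iff_coeff_eq_zero]
  intro k hk
  rw [coeff_toPoly, dif_neg (by omega)]

theorem evalCoeffs_zero (a : Fin (n + 1) → Matrix ρ μ ℂ) : evalCoeffs a 0 = a 0 := by
  rw [evalCoeffs, Finset.sum_eq_single 0]
  · simp
  · intro k _ hk
    rw [zero_pow, zero_smul]
    exact fun h => hk (Fin.ext h)
  · simp

variable [Fintype μ] [DecidableEq μ]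

theorem mapMatrix_toPoly (a : Fin (n + 1) → Matrix μ μ ℂ) (z : ℂ) :
    (evalRingHom z).mapMatrix (toPoly a) = evalCoeffs a z := by
  ext i j
  exact eval_toPoly a i j z

theorem eval_det_toPoly (a : Fin (n + 1) → Matrix μ μ ℂ) (z : ℂ) :
    (toPoly a).det.eval z = (evalCoeffs a z).det := by
  rw [← mapMatrix_toPoly, ← RingHom.map_det, coe_evalRingHom]

theorem eval_adjugate_toPoly (a : Fin (n + 1) → Matrix μ μ ℂ) (z : ℂ) (i j : μ) :
    ((toPoly a).adjugate i j).eval z = (evalCoeffs a z).adjugate i j := by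
  rw [← mapMatrix_toPoly, ← RingHom.map_adjugate]
  rfl

end toPoly

theorem eq_zero_of_circleAverage_nonpos {f : ℂ → ℝ} (hf : ContinuousOn f (sphere 0 1))
    (hnn : ∀ u ∈ sphere (0 : ℂ) 1, 0 ≤ f u) (h : circleAverage f 0 1 ≤ 0) {u : ℂ}
    (hu : u ∈ sphere (0 : ℂ) 1) : f u = 0 := by
  by_contra hne
  have hpos : 0 < f u := lt_of_le_of_ne (hnn u hu) (Ne.symm hne)
  have hmem : ∀ θ, circleMap (0 : ℂ) 1 θ ∈ sphere (0 : ℂ) 1 :=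
    fun θ => circleMap_mem_sphere 0 zero_le_one θ
  obtain ⟨θ, hθ, rfl⟩ : u ∈ circleMap 0 1 '' Set.Ioc 0 (2 * π) := by
    rw [image_circleMap_Ioc]
    simpa using hu
  have hint : 0 < ∫ θ in (0 : ℝ)..2 * π, f (circleMap 0 1 θ) := by
    refine intervalIntegral.integral_pos two_pi_pos ?_ (fun θ _ => hnn _ (hmem θ))
      ⟨θ, Set.Ioc_subset_Icc_self hθ, hpos⟩
    exact hf.comp (continuous_circleMap 0 1).continuousOn fun θ _ => hmem θ
  rw [circleAverage_def, smul_eq_mul] at h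
  have : 0 < (2 * π)⁻¹ := inv_pos.2 two_pi_pos
  exact absurd h (not_le.2 (mul_pos this hint))

theorem le_norm_eval_of_le_on_circle {f : ℂ[X]} (hf : ∀ z : ℂ, ‖z‖ ≤ 1 → f.eval z ≠ 0) {δ : ℝ}
    (hδ : 0 < δ) (h : ∀ z : ℂ, ‖z‖ = 1 → δ ≤ ‖f.eval z‖) {z : ℂ} (hz : ‖z‖ ≤ 1) :
    δ ≤ ‖f.eval z‖ := by
  have hd : DiffContOnCl ℂ (fun z => (f.eval z)⁻¹) (ball 0 1) := by
    refine DifferentiableOn.diffContOnCl ?_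
    rw [closure_ball _ one_ne_zero]
    intro u hu
    have hu : f.eval u ≠ 0 := hf u (by simpa using hu)
    exact (by fun_prop (disch := assumption) :
      DifferentiableAt ℂ (fun z => (f.eval z)⁻¹) u).differentiableWithinAt
  have := Complex.norm_le_of_forall_mem_frontier_norm_le isBounded_ball hd (C := δ⁻¹)
    (fun u hu => by
      rw [frontier_ball _ one_ne_zero] at hu
      rw [norm_inv]
      exact inv_anti₀ hδ (h u (by simpa using hu))) (z := z)
    (by rw [closure_ball _ one_ne_zero]; simpa using hz)
  rw [norm_inv] at this
  exact (inv_le_inv₀ (norm_pos_iff.2 (hf z hz)) hδ).1 this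

variable {n m : ℕ}

/-- The linearization `x ↦ aᴴ x + xᴴ a` of `a ↦ aᴴ a` is injective once the unitary constants are
ruled out by making `(a 0)ᴴ * x 0` Hermitian:
`G = x a⁻¹` is analytic in the disk and skew-Hermitian on the circle, while `G 0` is Hermitian, so
the mean value property of `trace (G * G)` forces `G = 0`. -/
theorem eq_zero_of_conjTranspose_mul_add_eq_zero
    (a x : Fin (n + 1) → Matrix (Fin m) (Fin m) ℂ)
    (hdet : ∀ z : ℂ, ‖z‖ ≤ 1 → (evalCoeffs a z).det ≠ 0)
    (h : ∀ z : ℂ, ‖z‖ = 1 →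
      (evalCoeffs a z)ᴴ * evalCoeffs x z + (evalCoeffs x z)ᴴ * evalCoeffs a z = 0)
    (h0 : ((a 0)ᴴ * x 0).IsHermitian) : x = 0 := by
  set G : ℂ → Matrix (Fin m) (Fin m) ℂ := fun z => evalCoeffs x z * (evalCoeffs a z)⁻¹ with hG
  have hunit : ∀ z : ℂ, ‖z‖ ≤ 1 → IsUnit (evalCoeffs a z).det := fun z hz => (hdet z hz).isUnit
  have hGd : ∀ i j, ∀ z ∈ closedBall (0 : ℂ) 1, DifferentiableAt ℂ (fun z => G z i j) z := by
    intro i j z hz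
    have e : ∀ z, G z i j =
        ((toPoly x * (toPoly a).adjugate) i j).eval z / (toPoly a).det.eval z := by
      intro z
      simp only [hG, inv_def, Matrix.mul_apply, Matrix.smul_apply, Ring.inverse_eq_inv',
        eval_finsetSum, eval_mul, eval_toPoly, eval_adjugate_toPoly, eval_det_toPoly, smul_eq_mul,
        Finset.sum_div]
      exact Finset.sum_congr rfl fun k _ => by ring
    have hz : (toPoly a).det.eval z ≠ 0 := by
      rw [eval_det_toPoly]; exact hdet z (by simpa using hz)
    simp only [e]
    fun_prop (disch := assumption)
  have hskew : ∀ z : ℂ, ‖z‖ = 1 → ∀ i j, G z j i = -conj (G z i j) := by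
    intro z hz i j
    have hu := hunit z hz.le
    have hu' : IsUnit ((evalCoeffs a z)ᴴ).det := by rw [det_conjTranspose]; exact hu.star
    have e : G z + (G z)ᴴ = 0 := by
      have := congrArg (fun Z => ((evalCoeffs a z)ᴴ)⁻¹ * Z * (evalCoeffs a z)⁻¹) (h z hz)
      simp only [mul_add, add_mul, mul_zero, zero_mul] at this
      rw [← mul_assoc, nonsing_inv_mul _ hu', one_mul, mul_assoc, mul_assoc, mul_nonsing_inv _ hu,
        mul_one] at this
      rw [← this, hG]
      simp only [conjTranspose_mul, conjTranspose_nonsing_inv]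
    have := congrFun (congrFun e j) i
    simp only [Matrix.add_apply, conjTranspose_apply, Matrix.zero_apply] at this
    exact eq_neg_of_add_eq_zero_left this
  have hherm : ∀ i j, G 0 j i = conj (G 0 i j) := by
    intro i j
    have hu : IsUnit (a 0).det := by simpa [evalCoeffs_zero] using hunit 0 (by simp)
    have hu' : IsUnit ((a 0)ᴴ).det := by rw [det_conjTranspose]; exact hu.star
    have e : (G 0)ᴴ = G 0 := by
      have := congrArg (fun Z => ((a 0)ᴴ)⁻¹ * Z * (a 0)⁻¹) h0
      simp only [conjTranspose_mul, conjTranspose_conjTranspose] at this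
      rw [mul_assoc, mul_assoc, mul_nonsing_inv _ hu, mul_one, ← mul_assoc,
        nonsing_inv_mul _ hu', one_mul] at this
      simp only [hG, evalCoeffs_zero, conjTranspose_mul, conjTranspose_nonsing_inv]
      exact this
    exact (congrFun (congrFun e j) i).symm
  set φ : ℂ → ℂ := fun z => ∑ i, ∑ j, G z i j * G z j i with hφ
  set ψ : ℂ → ℝ := fun z => ∑ i, ∑ j, ‖G z i j‖ ^ 2 with hψ
  have hφd : DifferentiableOn ℂ φ (closedBall 0 1) := by
    intro z hz
    refine DifferentiableAt.differentiableWithinAt ?_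
    refine DifferentiableAt.fun_sum fun i _ => DifferentiableAt.fun_sum fun j _ => ?_
    exact (hGd i j z hz).mul (hGd j i z hz)
  have hψc : ContinuousOn ψ (sphere 0 1) := by
    refine continuousOn_finsetSum _ fun i _ => continuousOn_finsetSum _ fun j _ => ?_
    intro z hz
    exact ((hGd i j z (sphere_subset_closedBall hz)).continuousAt.norm.pow 2).continuousWithinAt
  have hφcl : DiffContOnCl ℂ φ (ball 0 |(1 : ℝ)|) := by
    refine DifferentiableOn.diffContOnCl ?_
    rwa [abs_one, closure_ball _ one_ne_zero]
  have hsq : ∀ w : ℂ, w * conj w = ((‖w‖ ^ 2 : ℝ) : ℂ) := fun w => by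
    rw [Complex.mul_conj, Complex.normSq_eq_norm_sq]
  have hφ1 : ∀ z ∈ sphere (0 : ℂ) |(1 : ℝ)|, (φ z).re = -ψ z := by
    intro z hz
    have hz : ‖z‖ = 1 := by simpa using hz
    have : φ z = ((-ψ z : ℝ) : ℂ) := by
      simp only [hφ, hψ, Complex.ofReal_neg, Complex.ofReal_sum, ← Finset.sum_neg_distrib]
      refine Finset.sum_congr rfl fun i _ => Finset.sum_congr rfl fun j _ => ?_
      rw [hskew z hz i j, mul_neg, hsq]
    rw [this, Complex.ofReal_re]
  have hφ0 : 0 ≤ (φ 0).re := by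
    have : φ 0 = ((ψ 0 : ℝ) : ℂ) := by
      simp only [hφ, hψ, Complex.ofReal_sum]
      refine Finset.sum_congr rfl fun i _ => Finset.sum_congr rfl fun j _ => ?_
      rw [hherm i j, hsq]
    rw [this, Complex.ofReal_re]
    exact Finset.sum_nonneg fun i _ => Finset.sum_nonneg fun j _ => sq_nonneg _
  have hφi : CircleIntegrable φ 0 1 :=
    ContinuousOn.circleIntegrable zero_le_one (hφd.continuousOn.mono sphere_subset_closedBall)
  have havg : circleAverage ψ 0 1 ≤ 0 := by
    have h1 := Complex.reCLM.circleAverage_comp_comm hφi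
    rw [hφcl.circleAverage] at h1
    have h2 : circleAverage (Complex.reCLM ∘ φ) 0 1 = circleAverage (fun z => (-1 : ℝ) • ψ z) 0 1 :=
      circleAverage_congr_sphere fun z hz => by simpa using hφ1 z hz
    rw [h2, circleAverage_fun_smul] at h1
    simp only [Complex.reCLM_apply, smul_eq_mul] at h1
    linarith
  have hG0 : ∀ z ∈ sphere (0 : ℂ) 1, G z = 0 := by
    intro z hz
    have := eq_zero_of_circleAverage_nonpos hψc (fun z _ => Finset.sum_nonneg fun i _ =>
      Finset.sum_nonneg fun j _ => sq_nonneg _) havg hz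
    ext i j
    have h1 := (Finset.sum_eq_zero_iff_of_nonneg fun i _ => Finset.sum_nonneg fun j _ =>
      sq_nonneg _).1 this i (Finset.mem_univ i)
    have h2 := (Finset.sum_eq_zero_iff_of_nonneg fun j _ => sq_nonneg _).1 h1 j (Finset.mem_univ j)
    simpa using h2
  have hx0 : ∀ z ∈ sphere (0 : ℂ) 1, evalCoeffs x z = 0 := by
    intro z hz
    have := congrArg (· * evalCoeffs a z) (hG0 z hz)
    simpa only [hG, mul_assoc, nonsing_inv_mul _ (hunit z (by simpa using (mem_sphere.1 hz).le)),
      mul_one, zero_mul] using this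
  funext k
  ext i j
  have hpars := sum_range_sq_norm_coeff_eq_circleAverage (natDegree_toPoly_le x i j)
  rw [circleAverage_congr_sphere (f₂ := fun _ => (0 : ℝ)) (fun z hz => by
    have := hx0 z (by simpa using hz)
    simp [eval_toPoly, this]), circleAverage_const] at hpars
  have := (Finset.sum_eq_zero_iff_of_nonneg fun k _ => sq_nonneg _).1 hpars k
    (Finset.mem_range.2 k.2)
  rw [coeff_toPoly, dif_pos k.2] at this
  simpa using this

/-- `corr` as a real bilinear map. -/
noncomputable def corrBilin (n m : ℕ) : (Fin (n + 1) → Matrix (Fin m) (Fin m) ℂ) →ₗ[ℝ]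
    (Fin (n + 1) → Matrix (Fin m) (Fin m) ℂ) →ₗ[ℝ] Fin (n + 1) → Matrix (Fin m) (Fin m) ℂ :=
  LinearMap.mk₂ ℝ corr
    (fun a a' b => by
      ext1 k
      simp only [corr, Pi.add_apply, ← Finset.sum_add_distrib]
      refine Finset.sum_congr rfl fun i _ => Finset.sum_congr rfl fun j _ => ?_
      split_ifs <;> simp [conjTranspose_add, add_mul])
    (fun c a b => by
      ext1 k
      simp only [corr, Pi.smul_apply, Finset.smul_sum]
      refine Finset.sum_congr rfl fun i _ => Finset.sum_congr rfl fun j _ => ?_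
      split_ifs <;> simp [conjTranspose_smul])
    (fun a b b' => by
      ext1 k
      simp only [corr, Pi.add_apply, ← Finset.sum_add_distrib]
      refine Finset.sum_congr rfl fun i _ => Finset.sum_congr rfl fun j _ => ?_
      split_ifs <;> simp [mul_add])
    (fun c a b => by
      ext1 k
      simp only [corr, Pi.smul_apply, Finset.smul_sum]
      refine Finset.sum_congr rfl fun i _ => Finset.sum_congr rfl fun j _ => ?_
      split_ifs <;> simp)

theorem continuous_det_evalCoeffs :
    Continuous fun p : (Fin (n + 1) → Matrix (Fin m) (Fin m) ℂ) × ℂ =>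
      (evalCoeffs p.1 p.2).det := by
  refine Continuous.matrix_det ?_
  unfold evalCoeffs
  fun_prop

theorem continuous_corr :
    Continuous fun a : Fin (n + 1) → Matrix (Fin m) (Fin m) ℂ => corr a a := by
  refine continuous_pi fun k => continuous_finsetSum _ fun i _ =>
    continuous_finsetSum _ fun j _ => ?_
  split_ifs
  · fun_prop
  · fun_prop

/-- The gauge term `x ↦ (a 0)ᴴ * x 0 - (x 0)ᴴ * a 0`, which removes the freedom of multiplying `a`
by a constant unitary matrix. -/
noncomputable def gaugeTerm (a : Fin (n + 1) → Matrix (Fin m) (Fin m) ℂ) :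
    (Fin (n + 1) → Matrix (Fin m) (Fin m) ℂ) →ₗ[ℝ] Fin (n + 1) → Matrix (Fin m) (Fin m) ℂ where
  toFun x := Pi.single 0 ((a 0)ᴴ * x 0 - (x 0)ᴴ * a 0)
  map_add' x y := by
    rw [← Pi.single_add]
    congr 1
    simp only [Pi.add_apply, mul_add, conjTranspose_add, add_mul]
    abel
  map_smul' c x := by
    rw [RingHom.id_apply, ← Pi.single_smul]
    congr 1
    simp [conjTranspose_smul, smul_sub]

theorem eventually_exists_corr_eq (a : Fin (n + 1) → Matrix (Fin m) (Fin m) ℂ)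
    (hdet : ∀ z : ℂ, ‖z‖ ≤ 1 → (evalCoeffs a z).det ≠ 0) :
    ∀ᶠ T in 𝓝 (corr a a), (T 0).IsHermitian →
      ∃ b : Fin (n + 1) → Matrix (Fin m) (Fin m) ℂ, corr b b = T ∧
        ∀ z : ℂ, ‖z‖ ≤ 1 → (evalCoeffs b z).det ≠ 0 := by
  set B := (corrBilin n m).toContinuousBilinearMap with hB
  set g := LinearMap.toContinuousLinearMap (gaugeTerm a) with hg
  have hBapp : ∀ x y, B x y = corr x y := fun x y => rfl
  have hgapp : ∀ x, g x = Pi.single 0 ((a 0)ᴴ * x 0 - (x 0)ᴴ * a 0) := fun x => rfl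
  have hder := (B.hasStrictFDerivAt_of_bilinear (hasStrictFDerivAt_id a)
    (hasStrictFDerivAt_id a)).add (g.hasStrictFDerivAt (x := a))
  set Ψ : (Fin (n + 1) → Matrix (Fin m) (Fin m) ℂ) → Fin (n + 1) → Matrix (Fin m) (Fin m) ℂ :=
    fun x => corr x x + g x with hΨ
  obtain ⟨L, hLapp, hΨder⟩ : ∃ L : (Fin (n + 1) → Matrix (Fin m) (Fin m) ℂ) →L[ℝ]
      Fin (n + 1) → Matrix (Fin m) (Fin m) ℂ,
      (∀ x, L x = corr a x + corr x a + g x) ∧ HasStrictFDerivAt Ψ L a :=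
    ⟨_, fun x => rfl, hder⟩
  have hskew : ∀ x : Fin (n + 1) → Matrix (Fin m) (Fin m) ℂ,
      ((a 0)ᴴ * x 0 - (x 0)ᴴ * a 0)ᴴ = -((a 0)ᴴ * x 0 - (x 0)ᴴ * a 0) := fun x => by
    simp only [conjTranspose_sub, conjTranspose_mul, conjTranspose_conjTranspose, neg_sub]
  -- The Hermitian and the skew-Hermitian part of an identity hold separately.
  have hsep : ∀ H K : Matrix (Fin m) (Fin m) ℂ, Hᴴ = H → Kᴴ = -K → H + K = 0 → K = 0 := by
    intro H K hH hK h
    have h' := congrArg conjTranspose h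
    rw [conjTranspose_add, hH, hK, conjTranspose_zero] at h'
    have h2 : (2 : ℝ) • K = 0 := by
      rw [two_smul]
      calc K + K = (H + K) - (H + -K) := by abel
        _ = 0 := by rw [h, h', sub_zero]
    exact (smul_eq_zero.1 h2).resolve_left two_ne_zero
  have hinj : Function.Injective L := by
    rw [injective_iff_map_eq_zero]
    intro x hx
    rw [hLapp, hgapp] at hx
    set K := (a 0)ᴴ * x 0 - (x 0)ᴴ * a 0 with hK
    have hx0 := congrFun hx 0
    simp only [Pi.add_apply, Pi.single_eq_same, Pi.zero_apply] at hx0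
    have hK0 : K = 0 := by
      refine hsep _ _ ?_ (hskew x) hx0
      simp only [corr_zero, conjTranspose_add, conjTranspose_sum, conjTranspose_mul,
        conjTranspose_conjTranspose]
      exact add_comm _ _
    have hS : corr a x + corr x a = 0 := by simpa [hK0] using hx
    refine eq_zero_of_conjTranspose_mul_add_eq_zero a x hdet (fun z hz => ?_) ?_
    · rw [conjTranspose_evalCoeffs_mul a x hz, conjTranspose_evalCoeffs_mul x a hz, ← laurent_add,
        hS, add_comm (corr x a), hS]
      simp [laurent]
    · rw [IsHermitian, conjTranspose_mul, conjTranspose_conjTranspose]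
      exact (sub_eq_zero.1 hK0).symm
  have hsurj : L.range = ⊤ :=
    LinearMap.range_eq_top.2 (LinearMap.injective_iff_surjective.1 hinj)
  have hmap : Filter.map Ψ (𝓝 a) = 𝓝 (Ψ a) := hΨder.map_nhds_eq_of_surj hsurj
  have hΨa : Ψ a = corr a a := by
    simp only [hΨ, hgapp]
    rw [show ((a 0)ᴴ * a 0 - (a 0)ᴴ * a 0) = 0 from sub_self _, Pi.single_zero, add_zero]
  have hU : ∀ᶠ b in 𝓝 a, ∀ z ∈ closedBall (0 : ℂ) 1, (evalCoeffs b z).det ≠ 0 := by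
    refine (isCompact_closedBall (0 : ℂ) 1).eventually_forall_of_forall_eventually fun z hz => ?_
    exact continuous_det_evalCoeffs.continuousAt.eventually_ne (hdet z (by simpa using hz))
  have himg := image_mem_map (m := Ψ) hU
  rw [hmap, hΨa] at himg
  filter_upwards [himg] with T hT hT0
  obtain ⟨b, hb, hbT⟩ := hT
  refine ⟨b, ?_, fun z hz => hb z (by simpa using hz)⟩
  simp only [hΨ, hgapp] at hbT
  have h0 := congrFun hbT 0
  simp only [Pi.add_apply, Pi.single_eq_same] at h0
  have hK0 : (a 0)ᴴ * b 0 - (b 0)ᴴ * a 0 = 0 := by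
    refine hsep (corr b b 0 - T 0) _ ?_ (hskew b) (by rw [← h0]; abel)
    rw [conjTranspose_sub, (isHermitian_corr_zero b).eq, hT0.eq]
  rw [hK0, Pi.single_zero, add_zero] at hbT
  exact hbT

theorem exists_tendsto_subseq_of_sum_sq_le {b : ℕ → Fin (n + 1) → Matrix (Fin m) (Fin m) ℂ} {R : ℝ}
    (h : ∀ l, ∑ k, ∑ i, ∑ j, ‖b l k i j‖ ^ 2 ≤ R) :
    ∃ (a : Fin (n + 1) → Matrix (Fin m) (Fin m) ℂ) (φ : ℕ → ℕ), StrictMono φ ∧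
      Tendsto (b ∘ φ) atTop (𝓝 a) := by
  have hbound : ∀ l, b l ∈ closedBall (0 : Fin (n + 1) → Matrix (Fin m) (Fin m) ℂ) (R + 1) := by
    intro l
    have hR : 0 ≤ R := (Finset.sum_nonneg fun k _ => Finset.sum_nonneg fun i _ =>
      Finset.sum_nonneg fun j _ => sq_nonneg _).trans (h l)
    rw [mem_closedBall_zero_iff, pi_norm_le_iff_of_nonneg (by linarith)]
    intro k
    rw [Matrix.norm_le_iff (by linarith)]
    intro i j
    have h1 : ‖b l k i j‖ ^ 2 ≤ R := by
      refine le_trans ?_ (h l)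
      refine le_trans ?_ (Finset.single_le_sum (f := fun k => ∑ i, ∑ j, ‖b l k i j‖ ^ 2)
        (fun k _ => Finset.sum_nonneg fun i _ => Finset.sum_nonneg fun j _ => sq_nonneg _)
        (Finset.mem_univ k))
      refine le_trans ?_ (Finset.single_le_sum (f := fun i => ∑ j, ‖b l k i j‖ ^ 2)
        (fun i _ => Finset.sum_nonneg fun j _ => sq_nonneg _) (Finset.mem_univ i))
      exact Finset.single_le_sum (f := fun j => ‖b l k i j‖ ^ 2) (fun j _ => sq_nonneg _)
        (Finset.mem_univ j)
    nlinarith [sq_nonneg (‖b l k i j‖ - 1)]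
  obtain ⟨a, -, φ, hφ, hlim⟩ := tendsto_subseq_of_bounded isBounded_closedBall hbound
  exact ⟨a, φ, hφ, hlim⟩

theorem corr_single_one :
    corr (Pi.single 0 1 : Fin (n + 1) → Matrix (Fin m) (Fin m) ℂ) (Pi.single 0 1) =
      Pi.single 0 1 := by
  ext1 k
  rw [corr, Finset.sum_eq_single 0, Finset.sum_eq_single 0]
  · by_cases hk : k = 0
    · subst hk; simp
    · rw [Pi.single_eq_of_ne hk, if_neg]
      intro h
      apply hk
      ext
      simpa using h
  · intro j _ hj
    rw [Pi.single_eq_of_ne hj]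
    simp
  · simp
  · intro i _ hi
    rw [Pi.single_eq_of_ne hi]
    simp
  · simp

theorem laurent_single_one (z : ℂ) :
    laurent (Pi.single 0 1 : Fin (n + 1) → Matrix (Fin m) (Fin m) ℂ) (Pi.single 0 1) z = 1 := by
  rw [laurent, Finset.sum_eq_single 0]
  · simp
  · intro k _ hk
    rw [if_neg hk, Pi.single_eq_of_ne hk]
    simp
  · simp

/-- **Matrix Fejér–Riesz theorem**: a matrix Laurent polynomial that is positive definite on the
circle is `aᴴ a` for a matrix polynomial `a` invertible on the closed disk. The factorizable
polynomials are open by the inverse function theorem and relatively closed by compactness, and the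
positive definite ones are connected to the identity by a segment. -/
theorem exists_corr_eq_of_posDef (T : Fin (n + 1) → Matrix (Fin m) (Fin m) ℂ)
    (hT0 : (T 0).IsHermitian) (hT : ∀ z : ℂ, ‖z‖ = 1 → (laurent T T z).PosDef) :
    ∃ a : Fin (n + 1) → Matrix (Fin m) (Fin m) ℂ, corr a a = T ∧
      ∀ z : ℂ, ‖z‖ ≤ 1 → (evalCoeffs a z).det ≠ 0 := by
  set e : Fin (n + 1) → Matrix (Fin m) (Fin m) ℂ := Pi.single 0 1 with he
  set γ : ℝ → Fin (n + 1) → Matrix (Fin m) (Fin m) ℂ := fun t => (1 - t) • e + t • T with hγ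
  have hγc : Continuous γ := by fun_prop
  have hγ0 : ∀ t, (γ t 0).IsHermitian := by
    intro t
    simp only [hγ, he, Pi.add_apply, Pi.smul_apply, Pi.single_eq_same, IsHermitian,
      conjTranspose_add, conjTranspose_smul, conjTranspose_one, star_trivial, hT0.eq]
  have hγpos : ∀ t ∈ Set.Icc (0 : ℝ) 1, ∀ z : ℂ, ‖z‖ = 1 → (laurent (γ t) (γ t) z).PosDef := by
    intro t ht z hz
    simp only [hγ, laurent_add, laurent_smul, he, laurent_single_one]
    rcases eq_or_lt_of_le ht.1 with h0 | h0
    · rw [← h0]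
      simpa using PosDef.one
    · exact PosDef.posSemidef_add (PosSemidef.one.smul (sub_nonneg.2 ht.2)) ((hT z hz).smul h0)
  set U : Set ℝ := {t | ∃ a : Fin (n + 1) → Matrix (Fin m) (Fin m) ℂ, corr a a = γ t ∧
      ∀ z : ℂ, ‖z‖ ≤ 1 → (evalCoeffs a z).det ≠ 0} with hU
  have hUo : IsOpen U := by
    rw [isOpen_iff_mem_nhds]
    rintro t ⟨a, hat, had⟩
    have := eventually_exists_corr_eq a had
    rw [hat] at this
    filter_upwards [hγc.continuousAt.eventually this] with s hs
    exact hs (hγ0 s)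
  have hUc : closure U ∩ Set.Icc 0 1 ⊆ U := by
    rintro t ⟨htU, ht⟩
    obtain ⟨s, hsU, hst⟩ := mem_closure_iff_seq_limit.1 htU
    choose b hb hbd using hsU
    have hlimγ : Tendsto (fun l => γ (s l)) atTop (𝓝 (γ t)) := (hγc.tendsto t).comp hst
    have htr : Tendsto (fun l => ((γ (s l) 0).trace).re) atTop (𝓝 ((γ t 0).trace).re) := by
      have : Continuous fun S : Fin (n + 1) → Matrix (Fin m) (Fin m) ℂ => ((S 0).trace).re := by
        unfold Matrix.trace
        simp only [diag_apply]
        fun_prop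
      exact (this.tendsto _).comp hlimγ
    obtain ⟨R, hR⟩ := htr.bddAbove_range
    have hbR : ∀ l, ∑ k, ∑ i, ∑ j, ‖b l k i j‖ ^ 2 ≤ R := by
      intro l
      have h1 := trace_corr_zero (b l)
      rw [hb l] at h1
      have h2 := hR ⟨l, rfl⟩
      simp only [h1, Complex.ofReal_re] at h2
      exact h2
    obtain ⟨a, φ, hφ, hlim⟩ := exists_tendsto_subseq_of_sum_sq_le hbR
    have hcorr : corr a a = γ t := by
      refine tendsto_nhds_unique ((continuous_corr.tendsto a).comp hlim) ?_
      refine (hlimγ.comp hφ.tendsto_atTop).congr fun l => ?_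
      exact (hb (φ l)).symm
    have hcirc : ∀ z : ℂ, ‖z‖ = 1 → (evalCoeffs a z).det ≠ 0 := by
      intro z hz h0
      have h1 := (hγpos t ht z hz).det_pos
      rw [← hcorr, ← conjTranspose_evalCoeffs_mul a a hz, det_mul, h0, mul_zero] at h1
      exact lt_irrefl _ h1
    refine ⟨a, hcorr, ?_⟩
    -- `|det|` is bounded below on the circle uniformly along the sequence, hence on the disk.
    obtain ⟨x, hx, hmin⟩ := (isCompact_sphere (0 : ℂ) 1).exists_isMinOn ⟨1, by simp⟩
      (f := fun z => ‖(evalCoeffs a z).det‖)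
      ((continuous_det_evalCoeffs.comp (Continuous.prodMk_right a)).norm.continuousOn)
    set δ := ‖(evalCoeffs a x).det‖ with hδ
    have hδ0 : 0 < δ := norm_pos_iff.2 (hcirc x (by simpa using hx))
    have hev : ∀ᶠ c in 𝓝 a, ∀ z ∈ sphere (0 : ℂ) 1, δ / 2 < ‖(evalCoeffs c z).det‖ := by
      refine (isCompact_sphere (0 : ℂ) 1).eventually_forall_of_forall_eventually fun z hz => ?_
      refine continuous_det_evalCoeffs.norm.continuousAt.eventually_const_lt ?_
      exact lt_of_lt_of_le (half_lt_self hδ0) (hmin hz)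
    intro z hz h0
    have hlow : ∀ᶠ l in atTop, δ / 2 ≤ ‖(evalCoeffs ((b ∘ φ) l) z).det‖ := by
      filter_upwards [hlim.eventually hev] with l hl
      rw [← eval_det_toPoly]
      refine le_norm_eval_of_le_on_circle (fun w hw => ?_) (half_pos hδ0) (fun w hw => ?_) hz
      · rw [eval_det_toPoly]; exact hbd (φ l) w hw
      · rw [eval_det_toPoly]; exact (hl w (by simpa using hw)).le
    have hlimdet : Tendsto (fun l => ‖(evalCoeffs ((b ∘ φ) l) z).det‖) atTop
        (𝓝 ‖(evalCoeffs a z).det‖) :=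
      ((continuous_det_evalCoeffs.comp (Continuous.prodMk_left z)).norm.tendsto a).comp hlim
    have := ge_of_tendsto hlimdet hlow
    rw [h0, norm_zero] at this
    linarith
  have hU0 : (0 : ℝ) ∈ U := by
    refine ⟨e, ?_, fun z _ => ?_⟩
    · rw [he, corr_single_one]
      simp [hγ, he]
    · rw [evalCoeffs, Finset.sum_eq_single 0]
      · simp [he]
      · intro k _ hk
        rw [he, Pi.single_eq_of_ne hk, smul_zero]
      · simp
  obtain ⟨a, ha, had⟩ := isPreconnected_Icc.subset_of_closure_inter_subset hUo
    ⟨0, ⟨le_rfl, zero_le_one⟩, hU0⟩ hUc (show (1 : ℝ) ∈ Set.Icc 0 1 from ⟨zero_le_one, le_rfl⟩)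
  refine ⟨a, ?_, had⟩
  rw [ha]
  simp [hγ]

/-! ### Solving up to finitely many conditions -/

/-- The equation `K y = q` is solvable up to `k` linear conditions on `q`, by a vector `y` of
rational functions without poles in the closed disk; `d` is the common denominator. -/
def HasDefect {ι κ : Type*} [Fintype κ] (K : Matrix ι κ ℂ[X]) (k : ℕ) : Prop :=
  ∃ φ : (ι → ℂ[X]) →ₗ[ℂ] (Fin k → ℂ), ∀ q, φ q = 0 →
    ∃ (d : ℂ[X]) (y : κ → ℂ[X]), (∀ u : ℂ, ‖u‖ ≤ 1 → d.eval u ≠ 0) ∧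
      ∀ i, (K *ᵥ y) i = d * q i

/-- A linear combination of vectors of polynomials. -/
noncomputable def comb {κ : Type*} {k : ℕ} (c : Fin k → ℂ) (H : Fin k → κ → ℂ[X]) : κ → ℂ[X] :=
  fun j => ∑ l, C (c l) * H l j

theorem mulVec_comb {ι κ : Type*} [Fintype κ] {k : ℕ} (K : Matrix ι κ ℂ[X]) (c : Fin k → ℂ)
    (H : Fin k → κ → ℂ[X]) (i : ι) : (K *ᵥ comb c H) i = ∑ l, C (c l) * (K *ᵥ H l) i := by
  simp only [mulVec, dotProduct, comb, Finset.mul_sum]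
  rw [Finset.sum_comm]
  exact Finset.sum_congr rfl fun l _ => Finset.sum_congr rfl fun j _ => mul_left_comm _ _ _

theorem HasDefect.exists_lowNorm_le {ι κ : Type*} [Fintype ι] [Fintype κ] {M N : Matrix ι κ ℂ[X]}
    {k : ℕ} (hM : HasDefect M k) (hMN : CircleIsometric M N) (n : ℕ)
    (H : Fin (k + 1) → κ → ℂ[X]) :
    ∃ c : Fin (k + 1) → ℂ, c ≠ 0 ∧ lowNorm n (N *ᵥ comb c H) ≤ lowNorm n (M *ᵥ comb c H) := by
  obtain ⟨φ, hφ⟩ := hM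
  choose t q ht htq _ using fun l i => exists_eq_add_X_pow_mul n ((M *ᵥ H l) i)
  set ψ : (Fin (k + 1) → ℂ) →ₗ[ℂ] (Fin k → ℂ) := Fintype.linearCombination ℂ fun l => φ (q l)
    with hψ
  obtain ⟨c, hc, hc0⟩ := (LinearMap.ker ψ).exists_mem_ne_zero_of_ne_bot
    (LinearMap.ker_ne_bot_of_finrank_lt (by simp))
  refine ⟨c, hc0, ?_⟩
  have hq : φ (∑ l, c l • q l) = 0 := by
    rw [map_sum]
    simpa [hψ, Fintype.linearCombination_apply] using hc
  obtain ⟨d, y, hd, hy⟩ := hφ _ hq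
  refine lowNorm_mulVec_le hMN (t := ∑ l, c l • t l) (q := ∑ l, c l • q l) (fun i => ?_)
    (fun i => ?_) hd hy
  · rw [Finset.sum_apply]
    refine natDegree_sum_le_of_forall_le _ _ fun l _ => ?_
    exact (natDegree_smul_le _ _).trans (ht l i)
  · rw [mulVec_comb, Finset.sum_apply, Finset.sum_apply, Finset.mul_sum, ← Finset.sum_add_distrib]
    refine Finset.sum_congr rfl fun l _ => ?_
    rw [htq, mul_add, Pi.smul_apply, Pi.smul_apply, smul_eq_C_mul, smul_eq_C_mul]
    ring

/-- Block triangular systems with an invertible block `E` and a scalar pivot `r * s`, where `r`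
carries the zeros of the pivot in the disk: eliminating with `E` leaves divisibility by `r`. -/
theorem exists_block_solution {m k : ℕ} {E : Matrix (Fin m) (Fin m) ℂ[X]}
    (hE : ∀ u : ℂ, ‖u‖ ≤ 1 → E.det.eval u ≠ 0) (β : Fin m → ℂ[X]) {r s : ℂ[X]} (hr : r.Monic)
    (hrk : r.natDegree = k) (hs : ∀ u : ℂ, ‖u‖ ≤ 1 → s.eval u ≠ 0) :
    ∃ φ : (Fin (m + 1) → ℂ[X]) →ₗ[ℂ] (Fin k → ℂ), ∀ q, φ q = 0 →
      ∃ (d b : ℂ[X]) (y : Fin m → ℂ[X]), (∀ u : ℂ, ‖u‖ ≤ 1 → d.eval u ≠ 0) ∧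
        ∑ j, β j * y j + r * s * b = d * q 0 ∧ ∀ i, (E *ᵥ y) i = d * q (Fin.succ i) := by
  -- `ν q` is the numerator of `q 0 - β E⁻¹ q'`, where `q'` are the components after the first.
  set ν : (Fin (m + 1) → ℂ[X]) →ₗ[ℂ] ℂ[X] :=
    { toFun := fun q => E.det * q 0 - ∑ j, β j * ∑ i, E.adjugate j i * q (Fin.succ i)
      map_add' := fun q q' => by
        simp only [Pi.add_apply, mul_add, Finset.sum_add_distrib]
        ring
      map_smul' := fun c q => by
        simp only [Pi.smul_apply, smul_sub, mul_smul_comm, ← Finset.smul_sum, RingHom.id_apply] }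
    with hν
  refine ⟨(LinearMap.pi fun i : Fin k => lcoeff ℂ (i : ℕ)) ∘ₗ modByMonicHom r ∘ₗ ν,
    fun q hq => ?_⟩
  have hmod : ν q %ₘ r = 0 := by
    ext l
    rw [coeff_zero]
    rcases lt_or_ge l k with hl | hl
    · exact congrFun hq ⟨l, hl⟩
    · refine coeff_eq_zero_of_degree_lt ((degree_modByMonic_lt _ hr).trans_le ?_)
      rw [degree_eq_natDegree hr.ne_zero, hrk]
      exact_mod_cast hl
  obtain ⟨b, hb⟩ := (modByMonic_eq_zero_iff_dvd hr).1 hmod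
  have hb : E.det * q 0 - ∑ j, β j * ∑ i, E.adjugate j i * q (Fin.succ i) = r * b := hb
  refine ⟨s * E.det, b, fun j => s * ∑ i, E.adjugate j i * q (Fin.succ i), fun u hu => ?_, ?_,
    fun i => ?_⟩
  · rw [eval_mul]
    exact mul_ne_zero (hs u hu) (hE u hu)
  · have : ∑ j, β j * (s * ∑ i, E.adjugate j i * q (Fin.succ i)) =
        s * ∑ j, β j * ∑ i, E.adjugate j i * q (Fin.succ i) := by
      rw [Finset.mul_sum]
      exact Finset.sum_congr rfl fun j _ => mul_left_comm _ _ _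
    rw [this]
    linear_combination (-s) * hb
  · have h1 : (fun j => s * ∑ i, E.adjugate j i * q (Fin.succ i)) =
        s • (E.adjugate *ᵥ fun i => q (Fin.succ i)) := rfl
    rw [h1, mulVec_smul, mulVec_mulVec, mul_adjugate, smul_mulVec, one_mulVec]
    simp only [Pi.smul_apply, smul_eq_mul]
    ring

/-! ### Zeros in the disk -/

theorem exists_eq_mul_of_forall_circle_ne {f : ℂ[X]} (hf : ∀ u : ℂ, ‖u‖ = 1 → f.eval u ≠ 0) :
    ∃ r s : ℂ[X], f = r * s ∧ r.Monic ∧ r.natDegree = numDiskZeros f ∧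
      (∀ u : ℂ, r.eval u = 0 → ‖u‖ < 1) ∧ ∀ u : ℂ, ‖u‖ ≤ 1 → s.eval u ≠ 0 := by
  classical
  have hf0 : f ≠ 0 := fun h => hf 1 (by simp) (by simp [h])
  set R₁ := f.roots.filter fun a => ‖a‖ < 1 with hR₁
  set R₂ := f.roots.filter fun a => ¬‖a‖ < 1 with hR₂
  refine ⟨(R₁.map fun a => X - C a).prod, C f.leadingCoeff * (R₂.map fun a => X - C a).prod, ?_,
    monic_multiset_prod_of_monic _ _ fun a _ => monic_X_sub_C a, ?_, fun u hu => ?_,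
    fun u hu h0 => ?_⟩
  · have h1 := (IsAlgClosed.splits f).eq_prod_roots
    have h2 : R₁ + R₂ = f.roots := Multiset.filter_add_not _ _
    rw [← h2, Multiset.map_add, Multiset.prod_add] at h1
    conv_lhs => rw [h1]
    ring
  · rw [natDegree_multiset_prod_X_sub_C_eq_card, numDiskZeros, Multiset.countP_eq_card_filter]
  · rw [eval_multiset_prod, Multiset.map_map, Multiset.prod_eq_zero_iff, Multiset.mem_map] at hu
    obtain ⟨a, ha, h⟩ := hu
    simp only [Function.comp_apply, eval_sub, eval_X, eval_C, sub_eq_zero] at h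
    rw [h]
    exact (Multiset.mem_filter.1 ha).2
  · rw [eval_mul, eval_C, mul_eq_zero, eval_multiset_prod, Multiset.map_map,
      Multiset.prod_eq_zero_iff, Multiset.mem_map] at h0
    obtain h0 | ⟨a, ha, h⟩ := h0
    · exact hf0 (leadingCoeff_eq_zero.1 h0)
    · simp only [Function.comp_apply, eval_sub, eval_X, eval_C, sub_eq_zero] at h
      obtain ⟨ha1, ha2⟩ := Multiset.mem_filter.1 ha
      rw [← h] at ha1 ha2
      exact hf u (le_antisymm hu (not_lt.1 ha2)) ((mem_roots hf0).1 ha1)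

/-- The reflection of `f` has the zeros of `f` outside the closed disk, reflected into the disk,
and a zero at the origin of order the degree deficiency. -/
theorem exists_conjReflect_eq_mul {f : ℂ[X]} {n : ℕ} (hfn : f.natDegree ≤ n)
    (hf : ∀ u : ℂ, ‖u‖ = 1 → f.eval u ≠ 0) :
    ∃ (n₁ : ℕ) (r s : ℂ[X]), n₁ + numDiskZeros f = n ∧ conjReflect n f = r * s ∧ r.Monic ∧
      r.natDegree = n₁ ∧ ∀ u : ℂ, ‖u‖ ≤ 1 → s.eval u ≠ 0 := by
  obtain ⟨r, s, hrs, hr, hrd, hr0, hs0⟩ := exists_eq_mul_of_forall_circle_ne hf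
  have hs : s ≠ 0 := fun h => hs0 0 (by simp) (by simp [h])
  have hdeg : r.natDegree + s.natDegree ≤ n := by
    rw [← natDegree_mul hr.ne_zero hs, ← hrs]; exact hfn
  obtain ⟨n₁, hn₁⟩ : ∃ n₁, r.natDegree + n₁ = n := ⟨n - r.natDegree, by omega⟩
  have hsn : s.natDegree ≤ n₁ := by omega
  have hrefl : conjReflect n f = conjReflect r.natDegree r * conjReflect n₁ s := by
    rw [conjReflect, hrs, Polynomial.map_mul, ← hn₁, reflect_mul _ _ (natDegree_map_le ..)
      ((natDegree_map_le ..).trans hsn)]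
    rfl
  set c := conj (s.coeff 0) with hc
  have hc0 : c ≠ 0 := by
    rw [hc, Ne, map_eq_zero, coeff_zero_eq_eval_zero]
    exact hs0 0 (by simp)
  have hlead : (conjReflect n₁ s).coeff n₁ = c := by
    rw [coeff_conjReflect s le_rfl, Nat.sub_self]
  have hdegs : (conjReflect n₁ s).natDegree = n₁ :=
    natDegree_eq_of_le_of_coeff_ne_zero (natDegree_conjReflect_le hsn) (by rw [hlead]; exact hc0)
  refine ⟨n₁, C c⁻¹ * conjReflect n₁ s, C c * conjReflect r.natDegree r, by omega, ?_, ?_, ?_,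
    fun u hu => ?_⟩
  · have : (C c⁻¹ * C c : ℂ[X]) = 1 := by rw [← C_mul, inv_mul_cancel₀ hc0, C_1]
    rw [hrefl]
    linear_combination (-(conjReflect r.natDegree r * conjReflect n₁ s)) * this
  · rw [Monic, leadingCoeff, natDegree_C_mul (inv_ne_zero hc0), hdegs, coeff_C_mul, hlead,
      inv_mul_cancel₀ hc0]
  · rw [natDegree_C_mul (inv_ne_zero hc0), hdegs]
  · rw [eval_mul, eval_C]
    refine mul_ne_zero hc0 ?_
    by_cases hu0 : u = 0
    · rw [hu0, ← coeff_zero_eq_eval_zero, coeff_conjReflect r (Nat.zero_le _), Nat.sub_zero,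
        hr.coeff_natDegree, map_one]
      exact one_ne_zero
    · rw [eval_conjReflect le_rfl hu0]
      refine mul_ne_zero (pow_ne_zero _ hu0) fun h => ?_
      have h1 := hr0 _ ((map_eq_zero _).1 h)
      rw [norm_inv, Complex.norm_conj] at h1
      exact absurd h1 (not_lt.2 ((one_le_inv₀ (norm_pos_iff.2 hu0)).2 hu))

/-! ### The two bordered matrices -/

section Bordered

variable {m : ℕ}

/-- The rows `(α 0, …, α m)` and `(0, E i)`. -/
noncomputable def borderLeft (α : ℕ → ℂ[X]) (E : Matrix (Fin m) (Fin m) ℂ[X]) :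
    Matrix (Fin (m + 1)) (Fin (m + 1)) ℂ[X] :=
  fun i j => Fin.cases (α j) (fun i' => Fin.cases 0 (fun k => E i' k) j) i

/-- The rows `(α 0, …, α m)` and `(E i, 0)`. -/
noncomputable def borderRight (α : ℕ → ℂ[X]) (E : Matrix (Fin m) (Fin m) ℂ[X]) :
    Matrix (Fin (m + 1)) (Fin (m + 1)) ℂ[X] :=
  fun i j => Fin.cases (α j) (fun i' => Fin.lastCases 0 (fun k => E i' k) j) i

variable (α : ℕ → ℂ[X]) (E : Matrix (Fin m) (Fin m) ℂ[X])

@[simp] theorem borderLeft_zero (j : Fin (m + 1)) : borderLeft α E 0 j = α j := rfl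

@[simp] theorem borderRight_zero (j : Fin (m + 1)) : borderRight α E 0 j = α j := rfl

@[simp] theorem borderLeft_succ_zero (i : Fin m) : borderLeft α E i.succ 0 = 0 := rfl

@[simp] theorem borderLeft_succ_succ (i k : Fin m) : borderLeft α E i.succ k.succ = E i k := rfl

@[simp] theorem borderRight_succ_last (i : Fin m) : borderRight α E i.succ (Fin.last m) = 0 := by
  simp [borderRight]

@[simp] theorem borderRight_succ_castSucc (i k : Fin m) :
    borderRight α E i.succ k.castSucc = E i k := by
  simp [borderRight]

variable {α E}

theorem hasDefect_borderLeft {k : ℕ} {r s : ℂ[X]}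
    (hE : ∀ u : ℂ, ‖u‖ ≤ 1 → E.det.eval u ≠ 0) (hα : α 0 = r * s) (hr : r.Monic)
    (hrk : r.natDegree = k) (hs : ∀ u : ℂ, ‖u‖ ≤ 1 → s.eval u ≠ 0) :
    HasDefect (borderLeft α E) k := by
  obtain ⟨φ, hφ⟩ := exists_block_solution hE (fun j : Fin m => α (j + 1)) hr hrk hs
  refine ⟨φ, fun q hq => ?_⟩
  obtain ⟨d, b, y, hd, h0, h1⟩ := hφ q hq
  refine ⟨d, Fin.cons b y, hd, fun i => ?_⟩
  simp only [mulVec, dotProduct, Fin.sum_univ_succ (n := m)]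
  refine Fin.cases ?_ (fun i => ?_) i
  · simp only [borderLeft_zero, Fin.cons_zero, Fin.cons_succ, Fin.val_zero, Fin.val_succ, hα]
    rw [← h0]
    ring
  · simp only [borderLeft_succ_zero, borderLeft_succ_succ, Fin.cons_succ, zero_mul, zero_add]
    exact h1 i

theorem hasDefect_borderRight {k : ℕ} {r s : ℂ[X]}
    (hE : ∀ u : ℂ, ‖u‖ ≤ 1 → E.det.eval u ≠ 0) (hα : α m = r * s) (hr : r.Monic)
    (hrk : r.natDegree = k) (hs : ∀ u : ℂ, ‖u‖ ≤ 1 → s.eval u ≠ 0) :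
    HasDefect (borderRight α E) k := by
  obtain ⟨φ, hφ⟩ := exists_block_solution hE (fun j : Fin m => α j) hr hrk hs
  refine ⟨φ, fun q hq => ?_⟩
  obtain ⟨d, b, y, hd, h0, h1⟩ := hφ q hq
  refine ⟨d, Fin.snoc (α := fun _ => ℂ[X]) y b, hd, fun i => ?_⟩
  simp only [mulVec, dotProduct, Fin.sum_univ_castSucc (n := m)]
  refine Fin.cases ?_ (fun i => ?_) i
  · simp only [borderRight_zero, Fin.snoc_castSucc, Fin.snoc_last, Fin.val_castSucc, Fin.val_last,
      hα]
    rw [← h0]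
  · simp only [borderRight_succ_last, borderRight_succ_castSucc, Fin.snoc_castSucc, zero_mul,
      add_zero]
    exact h1 i

end Bordered

/-! ### The spectral factor of the parametrized Schur–Cohn matrix -/

/-- The coefficients in `w` of the reflection at the degree `(n, m)` of the polynomial
`∑ k, P k w ^ k`. -/
noncomputable def reflectSeq (n m : ℕ) (P : ℕ → ℂ[X]) : ℕ → ℂ[X] :=
  fun k => conjReflect n (P (m - k))

/-- The coefficients of degree at most `n` of a matrix of polynomials. -/
noncomputable def coeffSeq (n : ℕ) {ρ μ : Type*} (K : Matrix ρ μ ℂ[X]) :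
    Fin (n + 1) → Matrix ρ μ ℂ :=
  fun k => of fun i j => (K i j).coeff k

theorem evalCoeffs_coeffSeq {n : ℕ} {ρ μ : Type*} {K : Matrix ρ μ ℂ[X]}
    (hK : ∀ i j, (K i j).natDegree ≤ n) (z : ℂ) :
    evalCoeffs (coeffSeq n K) z = of fun i j => (K i j).eval z := by
  ext i j
  rw [of_apply, eval_eq_sum_range' (Nat.lt_succ_of_le (hK i j)), Finset.sum_range]
  simp only [evalCoeffs, coeffSeq, Matrix.sum_apply, Matrix.smul_apply, of_apply, smul_eq_mul]
  exact Finset.sum_congr rfl fun k _ => mul_comm _ _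

theorem sum_sq_norm_mulVec {ρ μ : Type*} [Fintype ρ] [Fintype μ] (K : Matrix ρ μ ℂ) (v : μ → ℂ) :
    ((∑ l, ‖(K *ᵥ v) l‖ ^ 2 : ℝ) : ℂ) = star v ⬝ᵥ ((Kᴴ * K) *ᵥ v) := by
  rw [← mulVec_mulVec, dotProduct_mulVec, ← star_mulVec, dotProduct, Complex.ofReal_sum]
  refine Finset.sum_congr rfl fun l _ => ?_
  rw [Pi.star_apply, RCLike.star_def, mul_comm, Complex.mul_conj, Complex.normSq_eq_norm_sq]

section

variable {n m : ℕ} {P : ℕ → ℂ[X]}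

/-- The polynomial `∑ k ≤ m, P k (z) w ^ k` in `w`. -/
noncomputable def sliceAt (m : ℕ) (P : ℕ → ℂ[X]) (z : ℂ) : ℂ[X] :=
  ∑ k ∈ Finset.range (m + 1), C ((P k).eval z) * X ^ k

theorem coeff_sliceAt (z : ℂ) {k : ℕ} (hk : k ≤ m) :
    (sliceAt m P z).coeff k = (P k).eval z := by
  simp only [sliceAt, finsetSum_coeff, coeff_C_mul_X_pow]
  rw [Finset.sum_ite_eq, if_pos (Finset.mem_range.2 (Nat.lt_succ_of_le hk))]

theorem natDegree_sliceAt_le (z : ℂ) : (sliceAt m P z).natDegree ≤ m :=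
  natDegree_sum_le_of_forall_le _ _ fun _ hk =>
    (natDegree_C_mul_X_pow_le _ _).trans (Nat.lt_succ_iff.1 (Finset.mem_range.1 hk))

theorem eval_reflectSeq (hP : ∀ k, (P k).natDegree ≤ n) {z : ℂ} (hz : ‖z‖ = 1) {k : ℕ}
    (hk : k ≤ m) :
    (reflectSeq n m P k).eval z = z ^ n * (conjReflect m (sliceAt m P z)).coeff k := by
  rw [reflectSeq, eval_conjReflect_of_norm_eq_one (hP _) hz, coeff_conjReflect _ hk,
    coeff_sliceAt z (Nat.sub_le m k)]

theorem natDegree_toeplitz_le (hP : ∀ k, (P k).natDegree ≤ n) (l : Fin (m + 1)) (j : Fin m) :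
    (toeplitz m P l j).natDegree ≤ n := by
  simp only [toeplitz]
  split_ifs
  · exact hP _
  · simp

theorem sum_sq_norm_toeplitz_mulVec (z : ℂ) (v : Fin m → ℂ) :
    ∑ l, ‖((of fun i j => (toeplitz m P i j).eval z) *ᵥ v) l‖ ^ 2 =
      ∑ l, ‖(toeplitz m (sliceAt m P z).coeff *ᵥ v) l‖ ^ 2 := by
  have : (of fun i j => (toeplitz m P i j).eval z) = toeplitz m (sliceAt m P z).coeff := by
    ext l j
    simp only [of_apply, toeplitz]
    split_ifs
    · rw [coeff_sliceAt]
      omega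
    · simp
  rw [this]

theorem sum_sq_norm_toeplitz_reflectSeq_mulVec (hP : ∀ k, (P k).natDegree ≤ n) {z : ℂ}
    (hz : ‖z‖ = 1) (v : Fin m → ℂ) :
    ∑ l, ‖((of fun i j => (toeplitz m (reflectSeq n m P) i j).eval z) *ᵥ v) l‖ ^ 2 =
      ∑ l, ‖(toeplitz m (conjReflect m (sliceAt m P z)).coeff *ᵥ v) l‖ ^ 2 := by
  have : (of fun i j => (toeplitz m (reflectSeq n m P) i j).eval z) =
      z ^ n • toeplitz m (conjReflect m (sliceAt m P z)).coeff := by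
    ext l j
    simp only [of_apply, toeplitz, Matrix.smul_apply, smul_eq_mul]
    split_ifs
    · rw [eval_reflectSeq hP hz]
      omega
    · simp
  rw [this, smul_mulVec]
  simp only [Pi.smul_apply, smul_eq_mul, norm_mul, norm_pow, hz, one_pow, one_mul]

/-- If `∑ k, P k w ^ k` has no zeros on the circle times the closed disk, then its Schur–Cohn
matrix, a positive definite Laurent polynomial in `z`, has an outer factor. -/
theorem exists_outer_factor (hP : ∀ k, (P k).natDegree ≤ n)
    (hne : ∀ z w : ℂ, ‖z‖ = 1 → ‖w‖ ≤ 1 →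
      ∑ k ∈ Finset.range (m + 1), (P k).eval z * w ^ k ≠ 0) :
    ∃ a : Fin (n + 1) → Matrix (Fin m) (Fin m) ℂ,
      (∀ z : ℂ, ‖z‖ ≤ 1 → (evalCoeffs a z).det ≠ 0) ∧
      CircleIsometric (borderRight (reflectSeq n m P) (toPoly a)) (borderLeft P (toPoly a)) ∧
      ∑ k, ∑ i, ∑ j, ‖a k i j‖ ^ 2 ≤
        ∑ k : Fin (n + 1), ∑ i, ∑ j, ‖(toeplitz m P i j).coeff k‖ ^ 2 := by
  have hR : ∀ k, (reflectSeq n m P k).natDegree ≤ n := fun k => natDegree_conjReflect_le (hP _)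
  set ℓ := coeffSeq n (toeplitz m P) with hℓ
  set μ := coeffSeq n (toeplitz m (reflectSeq n m P)) with hμ
  set T := corr ℓ ℓ - corr μ μ with hT
  have hg : ∀ z : ℂ, ‖z‖ = 1 → ∀ u : ℂ, ‖u‖ ≤ 1 → (sliceAt m P z).eval u ≠ 0 := by
    intro z hz u hu
    have : (sliceAt m P z).eval u = ∑ k ∈ Finset.range (m + 1), (P k).eval z * u ^ k := by
      simp [sliceAt, eval_finsetSum]
    rw [this]
    exact hne z u hz hu
  have hform : ∀ z : ℂ, ‖z‖ = 1 → ∀ v : Fin m → ℂ, star v ⬝ᵥ (laurent T T z *ᵥ v) =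
      ((∑ l, ‖(toeplitz m (sliceAt m P z).coeff *ᵥ v) l‖ ^ 2 -
        ∑ l, ‖(toeplitz m (conjReflect m (sliceAt m P z)).coeff *ᵥ v) l‖ ^ 2 : ℝ) : ℂ) := by
    intro z hz v
    rw [hT, laurent_sub, ← conjTranspose_evalCoeffs_mul ℓ ℓ hz,
      ← conjTranspose_evalCoeffs_mul μ μ hz, sub_mulVec, dotProduct_sub, ← sum_sq_norm_mulVec,
      ← sum_sq_norm_mulVec, hℓ, hμ, evalCoeffs_coeffSeq (natDegree_toeplitz_le hP),
      evalCoeffs_coeffSeq (natDegree_toeplitz_le hR), sum_sq_norm_toeplitz_mulVec,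
      sum_sq_norm_toeplitz_reflectSeq_mulVec hP hz, Complex.ofReal_sub]
  have hT0 : (T 0).IsHermitian := (isHermitian_corr_zero ℓ).sub (isHermitian_corr_zero μ)
  obtain ⟨a, ha, hdet⟩ := exists_corr_eq_of_posDef T hT0 fun z hz => by
    refine PosDef.of_dotProduct_mulVec_pos ?_ fun v hv => ?_
    · rw [hT, laurent_sub, ← conjTranspose_evalCoeffs_mul ℓ ℓ hz,
        ← conjTranspose_evalCoeffs_mul μ μ hz]
      exact (isHermitian_conjTranspose_mul_self _).sub (isHermitian_conjTranspose_mul_self _)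
    · rw [hform z hz v]
      exact Complex.zero_lt_real.2
        (sub_pos.2 (schurCohn_pos (natDegree_sliceAt_le z) (hg z hz) hv))
  refine ⟨a, hdet, fun z hz v => ?_, ?_⟩
  · have hA : ∀ v : Fin m → ℂ, ∑ i, ‖∑ k, (toPoly a i k).eval z * v k‖ ^ 2 =
        ∑ l, ‖(toeplitz m (sliceAt m P z).coeff *ᵥ v) l‖ ^ 2 -
        ∑ l, ‖(toeplitz m (conjReflect m (sliceAt m P z)).coeff *ᵥ v) l‖ ^ 2 := by
      intro v
      have h1 := sum_sq_norm_mulVec (evalCoeffs a z) v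
      rw [conjTranspose_evalCoeffs_mul a a hz, ha, hform z hz v] at h1
      rw [← Complex.ofReal_inj.1 h1]
      simp only [eval_toPoly]
      rfl
    have hshift := schurCohn_shift (g := sliceAt m P z) (natDegree_sliceAt_le z) v
    rw [← hA, ← hA] at hshift
    have e1 : ∑ k : Fin (m + 1), (sliceAt m P z).coeff k * v k =
        ∑ k : Fin (m + 1), (P k).eval z * v k :=
      Finset.sum_congr rfl fun k _ => by rw [coeff_sliceAt z (Nat.lt_succ_iff.1 k.2)]
    have e2 : ‖∑ k : Fin (m + 1), (conjReflect m (sliceAt m P z)).coeff k * v k‖ =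
        ‖∑ k : Fin (m + 1), (reflectSeq n m P k).eval z * v k‖ := by
      have : ∑ k : Fin (m + 1), (reflectSeq n m P k).eval z * v k =
          z ^ n * ∑ k : Fin (m + 1), (conjReflect m (sliceAt m P z)).coeff k * v k := by
        rw [Finset.mul_sum]
        exact Finset.sum_congr rfl fun k _ => by
          rw [eval_reflectSeq hP hz (Nat.lt_succ_iff.1 k.2), mul_assoc]
      rw [this, norm_mul, norm_pow, hz, one_pow, one_mul]
    rw [e1, e2] at hshift
    refine (Fin.sum_univ_succ _).trans (Eq.trans ?_ (Fin.sum_univ_succ _).symm)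
    have h3 : ∀ i : Fin m, ∑ j, (borderRight (reflectSeq n m P) (toPoly a) i.succ j).eval z * v j =
        ∑ k, (toPoly a i k).eval z * v k.castSucc := by
      intro i
      rw [Fin.sum_univ_castSucc]
      simp
    have h4 : ∀ i : Fin m, ∑ j, (borderLeft P (toPoly a) i.succ j).eval z * v j =
        ∑ k, (toPoly a i k).eval z * v k.succ := by
      intro i
      rw [Fin.sum_univ_succ]
      simp
    simp only [h3, h4, borderRight_zero, borderLeft_zero]
    linarith
  · have h1 := congrArg (fun S => ((S 0).trace).re) ha
    simp only [hT, Pi.sub_apply, trace_sub, trace_corr_zero, Complex.sub_re,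
      Complex.ofReal_re] at h1
    have h2 : 0 ≤ ∑ k, ∑ i, ∑ j, ‖μ k i j‖ ^ 2 := Finset.sum_nonneg fun k _ =>
      Finset.sum_nonneg fun i _ => Finset.sum_nonneg fun j _ => sq_nonneg _
    have h3 : ∑ k : Fin (n + 1), ∑ i, ∑ j, ‖(toeplitz m P i j).coeff k‖ ^ 2 =
        ∑ k, ∑ i, ∑ j, ‖ℓ k i j‖ ^ 2 := rfl
    rw [h3, h1]
    linarith

end

/-! ### Passage to the limit -/

section Limit

variable {ι κ : Type*} [Fintype ι] [Fintype κ]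

/-- Among any `k + 1` vectors of polynomials there is a nontrivial combination `H` such that the
truncated norm of `N H` is at most that of `M H`: the form `lowDiff n M N` has positive index at
most `k`. -/
def IndexLE (n k : ℕ) (M N : Matrix ι κ ℂ[X]) : Prop :=
  ∀ H : Fin (k + 1) → κ → ℂ[X], ∃ c : Fin (k + 1) → ℂ, c ≠ 0 ∧
    lowNorm n (N *ᵥ comb c H) ≤ lowNorm n (M *ᵥ comb c H)

theorem lowNorm_mulVec_comb_smul (n : ℕ) (K : Matrix ι κ ℂ[X]) {k : ℕ} (t : ℂ) (c : Fin k → ℂ)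
    (H : Fin k → κ → ℂ[X]) :
    lowNorm n (K *ᵥ comb (t • c) H) = ‖t‖ ^ 2 * lowNorm n (K *ᵥ comb c H) := by
  simp only [lowNorm, Finset.mul_sum]
  refine Finset.sum_congr rfl fun i _ => Finset.sum_congr rfl fun l _ => ?_
  have : (K *ᵥ comb (t • c) H) i = C t * (K *ᵥ comb c H) i := by
    simp only [mulVec_comb, Pi.smul_apply, smul_eq_mul, C_mul, mul_assoc, Finset.mul_sum]
  rw [this, coeff_C_mul, norm_mul, mul_pow]

theorem tendsto_lowNorm_mulVec_comb {n k : ℕ} {K : Matrix ι κ ℂ[X]} {Ks : ℕ → Matrix ι κ ℂ[X]}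
    (hK : ∀ i j l, Tendsto (fun s => (Ks s i j).coeff l) atTop (𝓝 ((K i j).coeff l)))
    {c : Fin k → ℂ} {cs : ℕ → Fin k → ℂ} (hc : Tendsto cs atTop (𝓝 c)) (H : Fin k → κ → ℂ[X]) :
    Tendsto (fun s => lowNorm n (Ks s *ᵥ comb (cs s) H)) atTop
      (𝓝 (lowNorm n (K *ᵥ comb c H))) := by
  refine tendsto_finsetSum _ fun i _ => tendsto_finsetSum _ fun l _ => ?_
  refine Tendsto.pow (Tendsto.norm ?_) 2
  simp only [mulVec_comb, finsetSum_coeff, coeff_C_mul]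
  refine tendsto_finsetSum _ fun t _ => ((tendsto_pi_nhds.1 hc) t).mul ?_
  simp only [mulVec, dotProduct, finsetSum_coeff, coeff_mul]
  refine tendsto_finsetSum _ fun j _ => tendsto_finsetSum _ fun x _ => ?_
  exact (hK i j _).mul_const _

theorem IndexLE.of_tendsto {n k : ℕ} {M N : Matrix ι κ ℂ[X]} {Ms Ns : ℕ → Matrix ι κ ℂ[X]}
    (hM : ∀ i j l, Tendsto (fun s => (Ms s i j).coeff l) atTop (𝓝 ((M i j).coeff l)))
    (hN : ∀ i j l, Tendsto (fun s => (Ns s i j).coeff l) atTop (𝓝 ((N i j).coeff l)))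
    (h : ∀ s, IndexLE n k (Ms s) (Ns s)) : IndexLE n k M N := by
  intro H
  have hex : ∀ s, ∃ c ∈ sphere (0 : Fin (k + 1) → ℂ) 1,
      lowNorm n (Ns s *ᵥ comb c H) ≤ lowNorm n (Ms s *ᵥ comb c H) := by
    intro s
    obtain ⟨c, hc, hle⟩ := h s H
    have hc' : ‖c‖ ≠ 0 := norm_ne_zero_iff.2 hc
    refine ⟨((‖c‖ : ℂ)⁻¹) • c, ?_, ?_⟩
    · rw [mem_sphere_zero_iff_norm, norm_smul, norm_inv, Complex.norm_real, norm_norm,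
        inv_mul_cancel₀ hc']
    · rw [lowNorm_mulVec_comb_smul, lowNorm_mulVec_comb_smul]
      exact mul_le_mul_of_nonneg_left hle (sq_nonneg _)
  choose c hc hle using hex
  obtain ⟨c₀, hc₀, φ, hφ, hlim⟩ := (isCompact_sphere (0 : Fin (k + 1) → ℂ) 1).tendsto_subseq hc
  refine ⟨c₀, fun h0 => ?_, ?_⟩
  · rw [mem_sphere_zero_iff_norm, h0, norm_zero] at hc₀
    exact zero_ne_one hc₀
  · exact le_of_tendsto_of_tendsto'
      (tendsto_lowNorm_mulVec_comb (fun i j l => (hN i j l).comp hφ.tendsto_atTop) hlim H)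
      (tendsto_lowNorm_mulVec_comb (fun i j l => (hM i j l).comp hφ.tendsto_atTop) hlim H)
      fun s => hle (φ s)

theorem CircleIsometric.of_tendsto {n : ℕ} {M N : Matrix ι κ ℂ[X]} {Ms Ns : ℕ → Matrix ι κ ℂ[X]}
    (hM : ∀ i j l, Tendsto (fun s => (Ms s i j).coeff l) atTop (𝓝 ((M i j).coeff l)))
    (hN : ∀ i j l, Tendsto (fun s => (Ns s i j).coeff l) atTop (𝓝 ((N i j).coeff l)))
    (hMn : ∀ i j, (M i j).natDegree ≤ n) (hNn : ∀ i j, (N i j).natDegree ≤ n)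
    (hMsn : ∀ s i j, (Ms s i j).natDegree ≤ n) (hNsn : ∀ s i j, (Ns s i j).natDegree ≤ n)
    (h : ∀ s, CircleIsometric (Ms s) (Ns s)) : CircleIsometric M N := by
  have key : ∀ {K : Matrix ι κ ℂ[X]} {Ks : ℕ → Matrix ι κ ℂ[X]},
      (∀ i j l, Tendsto (fun s => (Ks s i j).coeff l) atTop (𝓝 ((K i j).coeff l))) →
      (∀ i j, (K i j).natDegree ≤ n) → (∀ s i j, (Ks s i j).natDegree ≤ n) →
      ∀ (u : ℂ) (v : κ → ℂ), Tendsto (fun s => ∑ i, ‖∑ j, (Ks s i j).eval u * v j‖ ^ 2) atTop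
        (𝓝 (∑ i, ‖∑ j, (K i j).eval u * v j‖ ^ 2)) := by
    intro K Ks hK hKn hKsn u v
    refine tendsto_finsetSum _ fun i _ => Tendsto.pow (Tendsto.norm ?_) 2
    refine tendsto_finsetSum _ fun j _ => Tendsto.mul_const _ ?_
    simp only [fun s => eval_eq_sum_range' (Nat.lt_succ_of_le (hKsn s i j)) u,
      eval_eq_sum_range' (Nat.lt_succ_of_le (hKn i j)) u]
    exact tendsto_finsetSum _ fun l _ => (hK i j l).mul_const _
  intro u hu v
  refine tendsto_nhds_unique (key hM hMn hMsn u v) ?_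
  refine (key hN hNn hNsn u v).congr fun s => ?_
  exact (h s u hu v).symm

end Limit

section

variable {n m : ℕ}

theorem natDegree_borderLeft_le {α : ℕ → ℂ[X]} (hα : ∀ k, (α k).natDegree ≤ n)
    (a : Fin (n + 1) → Matrix (Fin m) (Fin m) ℂ) (i j : Fin (m + 1)) :
    (borderLeft α (toPoly a) i j).natDegree ≤ n := by
  refine Fin.cases ?_ (fun i => ?_) i
  · exact hα j
  · refine Fin.cases ?_ (fun j => ?_) j
    · simp
    · exact natDegree_toPoly_le a i j

theorem natDegree_borderRight_le {α : ℕ → ℂ[X]} (hα : ∀ k, (α k).natDegree ≤ n)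
    (a : Fin (n + 1) → Matrix (Fin m) (Fin m) ℂ) (i j : Fin (m + 1)) :
    (borderRight α (toPoly a) i j).natDegree ≤ n := by
  refine Fin.cases ?_ (fun i => ?_) i
  · exact hα j
  · refine Fin.lastCases ?_ (fun j => ?_) j
    · simp
    · rw [borderRight_succ_castSucc]
      exact natDegree_toPoly_le a i j

theorem tendsto_coeff_toPoly {a : Fin (n + 1) → Matrix (Fin m) (Fin m) ℂ}
    {as : ℕ → Fin (n + 1) → Matrix (Fin m) (Fin m) ℂ} (ha : Tendsto as atTop (𝓝 a))
    (i j : Fin m) (l : ℕ) :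
    Tendsto (fun s => (toPoly (as s) i j).coeff l) atTop (𝓝 ((toPoly a i j).coeff l)) := by
  simp only [coeff_toPoly]
  split_ifs with hl
  · have : Continuous fun b : Fin (n + 1) → Matrix (Fin m) (Fin m) ℂ => b ⟨l, hl⟩ i j := by fun_prop
    exact (this.tendsto a).comp ha
  · exact tendsto_const_nhds

theorem tendsto_coeff_borderLeft {α : ℕ → ℂ[X]} {αs : ℕ → ℕ → ℂ[X]}
    (hα : ∀ k l, Tendsto (fun s => (αs s k).coeff l) atTop (𝓝 ((α k).coeff l)))
    {a : Fin (n + 1) → Matrix (Fin m) (Fin m) ℂ}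
    {as : ℕ → Fin (n + 1) → Matrix (Fin m) (Fin m) ℂ} (ha : Tendsto as atTop (𝓝 a))
    (i j : Fin (m + 1)) (l : ℕ) :
    Tendsto (fun s => (borderLeft (αs s) (toPoly (as s)) i j).coeff l) atTop
      (𝓝 ((borderLeft α (toPoly a) i j).coeff l)) := by
  refine Fin.cases ?_ (fun i => ?_) i
  · exact hα j l
  · refine Fin.cases ?_ (fun j => ?_) j
    · exact tendsto_const_nhds
    · exact tendsto_coeff_toPoly ha i j l

theorem tendsto_coeff_borderRight {α : ℕ → ℂ[X]} {αs : ℕ → ℕ → ℂ[X]}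
    (hα : ∀ k l, Tendsto (fun s => (αs s k).coeff l) atTop (𝓝 ((α k).coeff l)))
    {a : Fin (n + 1) → Matrix (Fin m) (Fin m) ℂ}
    {as : ℕ → Fin (n + 1) → Matrix (Fin m) (Fin m) ℂ} (ha : Tendsto as atTop (𝓝 a))
    (i j : Fin (m + 1)) (l : ℕ) :
    Tendsto (fun s => (borderRight (αs s) (toPoly (as s)) i j).coeff l) atTop
      (𝓝 ((borderRight α (toPoly a) i j).coeff l)) := by
  refine Fin.cases ?_ (fun i => ?_) i
  · exact hα j l
  · refine Fin.lastCases ?_ (fun j => ?_) j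
    · simp only [borderRight_succ_last]
      exact tendsto_const_nhds
    · simp only [borderRight_succ_castSucc]
      exact tendsto_coeff_toPoly ha i j l

theorem natDegree_reflectSeq_le {P : ℕ → ℂ[X]} (hP : ∀ k, (P k).natDegree ≤ n) (k : ℕ) :
    (reflectSeq n m P k).natDegree ≤ n :=
  natDegree_conjReflect_le (hP _)

/-- Zeros with `‖w‖ = 1` are allowed: the polynomials `p (z, s w)`, `s < 1`, have none, their
outer factors are bounded, and the indices are semicontinuous. -/
theorem exists_factor_indexLE {P : ℕ → ℂ[X]} (hP : ∀ k, (P k).natDegree ≤ n)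
    (hne : ∀ z w : ℂ, ‖z‖ = 1 → ‖w‖ < 1 →
      ∑ k ∈ Finset.range (m + 1), (P k).eval z * w ^ k ≠ 0) :
    ∃ (n₁ : ℕ) (a : Fin (n + 1) → Matrix (Fin m) (Fin m) ℂ), n₁ + numDiskZeros (P 0) = n ∧
      CircleIsometric (borderRight (reflectSeq n m P) (toPoly a)) (borderLeft P (toPoly a)) ∧
      IndexLE n n₁ (borderRight (reflectSeq n m P) (toPoly a)) (borderLeft P (toPoly a)) ∧
      IndexLE n (numDiskZeros (P 0)) (borderLeft P (toPoly a))
        (borderRight (reflectSeq n m P) (toPoly a)) := by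
  have hP0 : ∀ u : ℂ, ‖u‖ = 1 → (P 0).eval u ≠ 0 := by
    intro u hu
    have := hne u 0 hu (by simp)
    rwa [Finset.sum_eq_single 0 (fun k _ hk => by rw [zero_pow hk, mul_zero]) (by simp), pow_zero,
      mul_one] at this
  obtain ⟨r, s, hrs, hr, hrd, -, hs⟩ := exists_eq_mul_of_forall_circle_ne hP0
  obtain ⟨n₁, r', s', hn₁, hrs', hr', hrd', hs'⟩ := exists_conjReflect_eq_mul (hP 0) hP0
  set t : ℕ → ℝ := fun l => 1 - 1 / ((l : ℝ) + 1) with ht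
  have ht0 : ∀ l, 0 ≤ t l := fun l => by
    rw [ht, sub_nonneg, div_le_one (by positivity)]
    have : (0 : ℝ) ≤ l := Nat.cast_nonneg l
    linarith
  have ht1 : ∀ l, t l < 1 := fun l => sub_lt_self _ (by positivity)
  have htlim : Tendsto t atTop (𝓝 1) := by
    simpa [ht] using (tendsto_one_div_add_atTop_nhds_zero_nat (𝕜 := ℝ)).const_sub 1
  set Q : ℕ → ℕ → ℂ[X] := fun l k => C ((t l : ℂ) ^ k) * P k with hQ
  have hQd : ∀ l k, (Q l k).natDegree ≤ n := fun l k => (natDegree_C_mul_le _ _).trans (hP k)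
  have hQ0 : ∀ l, Q l 0 = P 0 := fun l => by simp [hQ]
  have hQR : ∀ l, reflectSeq n m (Q l) m = conjReflect n (P 0) := fun l => by
    rw [reflectSeq, Nat.sub_self, hQ0]
  have hQlim : ∀ k l, Tendsto (fun s => (Q s k).coeff l) atTop (𝓝 ((P k).coeff l)) := by
    intro k l
    simp only [hQ, coeff_C_mul]
    have h1 : Tendsto (fun s => (t s : ℂ)) atTop (𝓝 ((1 : ℝ) : ℂ)) :=
      (Complex.continuous_ofReal.tendsto 1).comp htlim
    simpa using (h1.pow k).mul_const ((P k).coeff l)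
  have hQRlim : ∀ k l, Tendsto (fun s => (reflectSeq n m (Q s) k).coeff l) atTop
      (𝓝 ((reflectSeq n m P k).coeff l)) := by
    intro k l
    simp only [reflectSeq, conjReflect, coeff_reflect, coeff_map]
    exact (Complex.continuous_conj.tendsto _).comp (hQlim _ _)
  choose a hdet hiso hbound using fun l => exists_outer_factor (m := m) (hQd l) fun z w hz hw => by
    have := hne z (t l * w) hz (by
      rw [norm_mul, Complex.norm_real, Real.norm_of_nonneg (ht0 l)]
      exact (mul_le_of_le_one_right (ht0 l) hw).trans_lt (ht1 l))
    refine fun h0 => this ?_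
    rw [← h0]
    refine Finset.sum_congr rfl fun k _ => ?_
    simp only [hQ, eval_mul, eval_C]
    ring
  have hbound' : ∀ l, ∑ k, ∑ i, ∑ j, ‖a l k i j‖ ^ 2 ≤
      ∑ k : Fin (n + 1), ∑ i, ∑ j, ‖(toeplitz m P i j).coeff k‖ ^ 2 := by
    intro l
    refine (hbound l).trans ?_
    refine Finset.sum_le_sum fun k _ => Finset.sum_le_sum fun i _ => Finset.sum_le_sum fun j _ => ?_
    refine pow_le_pow_left₀ (norm_nonneg _) ?_ 2
    simp only [toeplitz]
    split_ifs
    · simp only [hQ, coeff_C_mul, norm_mul, norm_pow, Complex.norm_real,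
        Real.norm_of_nonneg (ht0 l)]
      exact mul_le_of_le_one_left (norm_nonneg _) (pow_le_one₀ (ht0 l) (ht1 l).le)
    · exact le_rfl
  obtain ⟨b, φ, hφ, hlim⟩ := exists_tendsto_subseq_of_sum_sq_le hbound'
  have hLlim := tendsto_coeff_borderLeft
    (fun k l => (hQlim k l).comp hφ.tendsto_atTop) hlim
  have hRlim := tendsto_coeff_borderRight
    (fun k l => (hQRlim k l).comp hφ.tendsto_atTop) hlim
  have hEdet : ∀ l, ∀ u : ℂ, ‖u‖ ≤ 1 → (toPoly (a l)).det.eval u ≠ 0 := fun l u hu => by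
    rw [eval_det_toPoly]; exact hdet l u hu
  refine ⟨n₁, b, hn₁, ?_, ?_, ?_⟩
  · exact CircleIsometric.of_tendsto hRlim hLlim
      (natDegree_borderRight_le (natDegree_reflectSeq_le hP) b) (natDegree_borderLeft_le hP b)
      (fun l => natDegree_borderRight_le (natDegree_reflectSeq_le (hQd _)) _)
      (fun l => natDegree_borderLeft_le (hQd _) _) fun l => hiso (φ l)
  · refine IndexLE.of_tendsto hRlim hLlim fun l => ?_
    have hdef : HasDefect (borderRight (reflectSeq n m (Q (φ l))) (toPoly (a (φ l)))) n₁ :=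
      hasDefect_borderRight (hEdet _) ((hQR _).trans hrs') hr' hrd' hs'
    exact hdef.exists_lowNorm_le (hiso (φ l)) n
  · refine IndexLE.of_tendsto hLlim hRlim fun l => ?_
    have hdef : HasDefect (borderLeft (Q (φ l)) (toPoly (a (φ l)))) (numDiskZeros (P 0)) :=
      hasDefect_borderLeft (hEdet _) ((hQ0 _).trans hrs) hr hrd hs
    exact hdef.exists_lowNorm_le (hiso (φ l)).symm n

end

/-! ### Diagonalization -/

theorem exists_fin_family {σ τ : Type*} [Fintype τ] {s : Finset σ} {k : ℕ} (hs : s.card ≤ k)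
    (b : σ → τ → ℂ) :
    ∃ B : Fin k → τ → ℂ, ∀ h, ∑ i ∈ s, ‖b i ⬝ᵥ h‖ ^ 2 = ∑ j, ‖B j ⬝ᵥ h‖ ^ 2 := by
  obtain ⟨f⟩ : Nonempty (s ↪ Fin k) :=
    Function.Embedding.nonempty_of_card_le (by simpa using hs)
  refine ⟨Function.extend f (fun i => b i) 0, fun h => ?_⟩
  rw [← Finset.sum_coe_sort]
  refine Fintype.sum_of_injective f f.injective _ _ (fun j hj => ?_) fun i => ?_
  · rw [Function.extend_apply' _ _ _ (by simpa using hj)]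
    simp
  · rw [f.injective.extend_apply]

section Spectral

variable {ι ρ : Type*} [Fintype ι] [Fintype ρ]

theorem exists_sq_norm_eq_sum_eigenvalues [DecidableEq ι] (S R : Matrix ρ ι ℂ) :
    ∃ (ev : ι → ℝ) (U : Matrix ι ι ℂ), Uᴴ * U = 1 ∧
      ∀ h, ∑ i, ‖(S *ᵥ h) i‖ ^ 2 - ∑ i, ‖(R *ᵥ h) i‖ ^ 2 = ∑ i, ev i * ‖(Uᴴ *ᵥ h) i‖ ^ 2 := by
  have hG : (Sᴴ * S - Rᴴ * R).IsHermitian :=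
    (isHermitian_conjTranspose_mul_self S).sub (isHermitian_conjTranspose_mul_self R)
  refine ⟨hG.eigenvalues, hG.eigenvectorUnitary, ?_, fun h => ?_⟩
  · exact Unitary.coe_star_mul_self hG.eigenvectorUnitary
  · have hspec := hG.spectral_theorem
    rw [Unitary.conjStarAlgAut_apply] at hspec
    apply Complex.ofReal_injective
    rw [Complex.ofReal_sub, sum_sq_norm_mulVec, sum_sq_norm_mulVec, ← dotProduct_sub, ← sub_mulVec]
    conv_lhs => rw [hspec, ← mulVec_mulVec, ← mulVec_mulVec, dotProduct_mulVec]
    have : star h ᵥ* (hG.eigenvectorUnitary : Matrix ι ι ℂ) =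
        star ((hG.eigenvectorUnitary : Matrix ι ι ℂ)ᴴ *ᵥ h) := by
      rw [star_mulVec, conjTranspose_conjTranspose]
    rw [this, Complex.ofReal_sum, dotProduct]
    refine Finset.sum_congr rfl fun i _ => ?_
    rw [mulVec_diagonal, Pi.star_apply, star_eq_conjTranspose, Complex.ofReal_mul,
      ← Complex.normSq_eq_norm_sq, ← Complex.mul_conj]
    simp only [Function.comp_apply, RCLike.star_def, Complex.coe_algebraMap]
    ring

/-- The eigenvectors `U i` with `ev i > 0` span a space on which the form is positive definite, so
there are at most `k` of them. -/
theorem card_pos_le {ev : ι → ℝ} {U : Matrix ι ι ℂ} [DecidableEq ι] (hU : Uᴴ * U = 1) {k : ℕ}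
    (h : ∀ v : Fin (k + 1) → ι → ℂ, ∃ c : Fin (k + 1) → ℂ, c ≠ 0 ∧
      ∑ i, ev i * ‖(Uᴴ *ᵥ ∑ l, c l • v l) i‖ ^ 2 ≤ 0) :
    (Finset.univ.filter fun i => 0 < ev i).card ≤ k := by
  by_contra hlt
  obtain ⟨f⟩ : Nonempty (Fin (k + 1) ↪ (Finset.univ.filter fun i => 0 < ev i)) :=
    Function.Embedding.nonempty_of_card_le (by
      rw [Fintype.card_coe, Fintype.card_fin]
      omega)
  obtain ⟨c, hc, hle⟩ := h fun l => U *ᵥ Pi.single (f l : ι) 1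
  have e : (Uᴴ *ᵥ ∑ l, c l • (U *ᵥ Pi.single (f l : ι) 1)) =
      ∑ l, c l • Pi.single (f l : ι) (1 : ℂ) := by
    rw [mulVec_sum]
    refine Finset.sum_congr rfl fun l _ => ?_
    rw [mulVec_smul, mulVec_mulVec, hU, one_mulVec]
  have happ : ∀ i, (∑ l, c l • Pi.single (f l : ι) (1 : ℂ)) i =
      ∑ l, if (f l : ι) = i then c l else 0 := by
    intro i
    rw [Finset.sum_apply]
    refine Finset.sum_congr rfl fun l _ => ?_
    simp only [Pi.smul_apply, Pi.single_apply, smul_eq_mul, mul_ite, mul_one, mul_zero, eq_comm]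
  have happ1 : ∀ l, (∑ l, c l • Pi.single (f l : ι) (1 : ℂ)) (f l : ι) = c l := by
    intro l
    rw [happ, Finset.sum_eq_single l]
    · simp
    · intro l' _ hl'
      exact if_neg fun h => hl' (f.injective (Subtype.ext h))
    · simp
  have hnn : ∀ i, 0 ≤ ev i * ‖(∑ l, c l • Pi.single (f l : ι) (1 : ℂ)) i‖ ^ 2 := by
    intro i
    by_cases hi : ∃ l, (f l : ι) = i
    · obtain ⟨l, rfl⟩ := hi
      exact mul_nonneg (Finset.mem_filter.1 (f l).2).2.le (sq_nonneg _)
    · rw [happ, Finset.sum_eq_zero fun l _ => if_neg fun h => hi ⟨l, h⟩]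
      simp
  rw [e] at hle
  obtain ⟨l, hl⟩ := Function.ne_iff.1 hc
  have hz := (Finset.sum_eq_zero_iff_of_nonneg fun i _ => hnn i).1
    (le_antisymm hle (Finset.sum_nonneg fun i _ => hnn i)) (f l) (Finset.mem_univ _)
  rw [happ1] at hz
  have hpos := (Finset.mem_filter.1 (f l).2).2
  exact (mul_pos hpos (pow_pos (norm_pos_iff.2 hl) 2)).ne' hz

/-- A difference of two square norms of index at most `(k₁, k₂)` is a difference of `k₁` and `k₂`
squares. -/
theorem exists_sum_sq_sub_sum_sq (S R : Matrix ρ ι ℂ) {k₁ k₂ : ℕ}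
    (h₁ : ∀ v : Fin (k₁ + 1) → ι → ℂ, ∃ c : Fin (k₁ + 1) → ℂ, c ≠ 0 ∧
      ∑ i, ‖(S *ᵥ ∑ l, c l • v l) i‖ ^ 2 ≤ ∑ i, ‖(R *ᵥ ∑ l, c l • v l) i‖ ^ 2)
    (h₂ : ∀ v : Fin (k₂ + 1) → ι → ℂ, ∃ c : Fin (k₂ + 1) → ℂ, c ≠ 0 ∧
      ∑ i, ‖(R *ᵥ ∑ l, c l • v l) i‖ ^ 2 ≤ ∑ i, ‖(S *ᵥ ∑ l, c l • v l) i‖ ^ 2) :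
    ∃ (B : Fin k₁ → ι → ℂ) (C : Fin k₂ → ι → ℂ), ∀ h,
      ∑ i, ‖(S *ᵥ h) i‖ ^ 2 - ∑ i, ‖(R *ᵥ h) i‖ ^ 2 =
        ∑ j, ‖B j ⬝ᵥ h‖ ^ 2 - ∑ j, ‖C j ⬝ᵥ h‖ ^ 2 := by
  classical
  obtain ⟨ev, U, hU, hev⟩ := exists_sq_norm_eq_sum_eigenvalues S R
  have hp : (Finset.univ.filter fun i => 0 < ev i).card ≤ k₁ := by
    refine card_pos_le hU fun v => ?_
    obtain ⟨c, hc, hle⟩ := h₁ v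
    exact ⟨c, hc, by rw [← hev]; linarith⟩
  have hn : (Finset.univ.filter fun i => 0 < -ev i).card ≤ k₂ := by
    refine card_pos_le hU fun v => ?_
    obtain ⟨c, hc, hle⟩ := h₂ v
    refine ⟨c, hc, ?_⟩
    simp only [neg_mul, Finset.sum_neg_distrib]
    rw [← hev]
    linarith
  obtain ⟨B, hB⟩ := exists_fin_family hp fun i => (√(ev i) : ℂ) • Uᴴ i
  obtain ⟨C, hC⟩ := exists_fin_family hn fun i => (√(-ev i) : ℂ) • Uᴴ i
  refine ⟨B, C, fun h => ?_⟩
  rw [hev, ← hB, ← hC, Finset.sum_filter, Finset.sum_filter, ← Finset.sum_sub_distrib]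
  refine Finset.sum_congr rfl fun i _ => ?_
  have hm : (Uᴴ *ᵥ h) i = Uᴴ i ⬝ᵥ h := rfl
  rw [hm]
  simp only [smul_dotProduct, smul_eq_mul, norm_mul, mul_pow, Complex.norm_real, Real.norm_eq_abs,
    sq_abs]
  rcases lt_trichotomy (ev i) 0 with h0 | h0 | h0
  · rw [if_neg (not_lt.2 h0.le), if_pos (neg_pos.2 h0), Real.sq_sqrt (neg_pos.2 h0).le]
    ring
  · simp [h0]
  · rw [if_pos h0, if_neg (by linarith), Real.sq_sqrt h0.le]
    ring

end Spectral

section Form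

variable {ι κ : Type*}

/-- The vector of polynomials `∑ j ≤ n, u ^ (n - j) h (j, c)`; this is `revPoly` for a vector `h`
with a finite index set. -/
noncomputable def polyOf (n : ℕ) (h : Fin (n + 1) × κ → ℂ) : κ → ℂ[X] := fun c =>
  ∑ j : Fin (n + 1), C (h (j, c)) * X ^ (n - (j : ℕ))

theorem comb_polyOf {n k : ℕ} (c : Fin k → ℂ) (v : Fin k → Fin (n + 1) × κ → ℂ) :
    comb c (fun l => polyOf n (v l)) = polyOf n (∑ l, c l • v l) := by
  ext1 j
  simp only [comb, polyOf, Finset.mul_sum, Finset.sum_apply, Pi.smul_apply, smul_eq_mul, map_sum,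
    C_mul, Finset.sum_mul, mul_assoc]
  rw [Finset.sum_comm]

variable [Fintype ι] [Fintype κ]

/-- The matrix taking `h` to the coefficients of degree at most `n` of `K * polyOf n h`. -/
noncomputable def lowMatrix (n : ℕ) (K : Matrix ι κ ℂ[X]) :
    Matrix (ι × Fin (n + 1)) (Fin (n + 1) × κ) ℂ :=
  fun i x => (K i.1 x.2 * X ^ (n - (x.1 : ℕ))).coeff i.2

theorem lowNorm_mulVec_polyOf (n : ℕ) (K : Matrix ι κ ℂ[X]) (h : Fin (n + 1) × κ → ℂ) :
    lowNorm n (K *ᵥ polyOf n h) = ∑ i, ‖(lowMatrix n K *ᵥ h) i‖ ^ 2 := by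
  rw [Fintype.sum_prod_type]
  refine Finset.sum_congr rfl fun i _ => ?_
  rw [Finset.sum_range]
  refine Finset.sum_congr rfl fun l _ => ?_
  congr 2
  simp only [mulVec, dotProduct, polyOf, lowMatrix]
  rw [Fintype.sum_prod_type_right, finsetSum_coeff]
  refine Finset.sum_congr rfl fun c _ => ?_
  rw [Finset.mul_sum, finsetSum_coeff]
  refine Finset.sum_congr rfl fun j _ => ?_
  rw [mul_left_comm, coeff_C_mul, mul_comm]

theorem IndexLE.exists_sum_sq_sub_sum_sq {M N : Matrix ι κ ℂ[X]} {n k₁ k₂ : ℕ}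
    (h₁ : IndexLE n k₁ M N) (h₂ : IndexLE n k₂ N M) :
    ∃ (B : Fin k₁ → Fin (n + 1) × κ → ℂ) (C : Fin k₂ → Fin (n + 1) × κ → ℂ), ∀ h,
      lowDiff n M N (polyOf n h) = ∑ j, ‖B j ⬝ᵥ h‖ ^ 2 - ∑ j, ‖C j ⬝ᵥ h‖ ^ 2 := by
  simp only [lowDiff, lowNorm_mulVec_polyOf]
  refine _root_.exists_sum_sq_sub_sum_sq _ _ (fun v => ?_) fun v => ?_
  · obtain ⟨c, hc, hle⟩ := h₁ fun l => polyOf n (v l)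
    rw [comb_polyOf, lowNorm_mulVec_polyOf, lowNorm_mulVec_polyOf] at hle
    exact ⟨c, hc, hle⟩
  · obtain ⟨c, hc, hle⟩ := h₂ fun l => polyOf n (v l)
    rw [comb_polyOf, lowNorm_mulVec_polyOf, lowNorm_mulVec_polyOf] at hle
    exact ⟨c, hc, hle⟩

/-- The identity `‖N(z) W‖² - ‖M(z) W‖² = (1 - |z|²) lowDiff`, the form being evaluated at the
vector with components `z ^ j W c`. -/
theorem sum_sq_norm_eval_sub_eq {M N : Matrix ι κ ℂ[X]} (hMN : CircleIsometric M N) {n : ℕ}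
    (hM : ∀ i j, (M i j).natDegree ≤ n) (hN : ∀ i j, (N i j).natDegree ≤ n) (z : ℂ) (W : κ → ℂ) :
    ∑ i, ‖∑ c, (N i c).eval z * W c‖ ^ 2 - ∑ i, ‖∑ c, (M i c).eval z * W c‖ ^ 2 =
      (1 - ‖z‖ ^ 2) * lowDiff n M N (polyOf n fun x => z ^ (x.1 : ℕ) * W x.2) := by
  have key := sum_sq_norm_sub_eq_lowDiff_sub hMN hM hN fun j c => z ^ j * W c
  have e : ∀ K : Matrix ι κ ℂ[X], (∀ i j, (K i j).natDegree ≤ n) → ∀ i,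
      ∑ c, ∑ j ∈ Finset.range (n + 1), (K i c).coeff j * (z ^ j * W c) =
        ∑ c, (K i c).eval z * W c := by
    intro K hK i
    refine Finset.sum_congr rfl fun c _ => ?_
    rw [eval_eq_sum_range' (Nat.lt_succ_of_le (hK i c)), Finset.sum_mul]
    exact Finset.sum_congr rfl fun j _ => (mul_assoc _ _ _).symm
  have e1 : revPoly n (fun j c => z ^ j * W c) =
      polyOf n fun x : Fin (n + 1) × κ => z ^ (x.1 : ℕ) * W x.2 := by
    ext1 c
    exact Finset.sum_range _
  have e2 : ∀ K : Matrix ι κ ℂ[X], lowNorm n (K *ᵥ revPoly n fun j c => z ^ (j + 1) * W c) =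
      ‖z‖ ^ 2 * lowNorm n (K *ᵥ revPoly n fun j c => z ^ j * W c) := by
    intro K
    have h1 : (revPoly n fun j c => z ^ (j + 1) * W c) =
        C z • revPoly n fun j c => z ^ j * W c := by
      ext1 c
      simp only [revPoly, Pi.smul_apply, smul_eq_mul, Finset.mul_sum]
      refine Finset.sum_congr rfl fun j _ => ?_
      rw [← mul_assoc, ← C_mul, ← mul_assoc, pow_succ']
    rw [h1, mulVec_smul]
    simp only [lowNorm, Pi.smul_apply, smul_eq_mul, coeff_C_mul, norm_mul, mul_pow,
      Finset.mul_sum]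
  simp only [e N hN, e M hM] at key
  rw [key]
  simp only [lowDiff, e2, e1]
  ring

end Form

/-! ### Bivariate polynomials -/

/-- The coefficient of `w ^ k` in `p(z, w)`, as a polynomial in `z`. -/
noncomputable def wCoeff (p : MvPolynomial (Fin 2) ℂ) (k : ℕ) : ℂ[X] :=
  ∑ s ∈ p.support, if s 1 = k then C (p.coeff s) * X ^ s 0 else 0

section

variable {p : MvPolynomial (Fin 2) ℂ} {n m : ℕ}

theorem natDegree_wCoeff_le (hn : p.degreeOf 0 ≤ n) (k : ℕ) : (wCoeff p k).natDegree ≤ n := by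
  refine natDegree_sum_le_of_forall_le _ _ fun s hs => ?_
  split_ifs
  · exact (natDegree_C_mul_X_pow_le _ _).trans (MvPolynomial.degreeOf_le_iff.1 hn s hs)
  · simp

theorem sum_eval_wCoeff_mul_pow (hm : p.degreeOf 1 ≤ m) (z w : ℂ) :
    ∑ k ∈ Finset.range (m + 1), (wCoeff p k).eval z * w ^ k = evalAt p z w := by
  unfold evalAt
  simp only [wCoeff, eval_finsetSum, Finset.sum_mul]
  rw [MvPolynomial.eval_eq', Finset.sum_comm]
  refine Finset.sum_congr rfl fun s hs => ?_
  have h1 : s 1 ≤ m := MvPolynomial.degreeOf_le_iff.1 hm s hs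
  rw [Finset.sum_eq_single (s 1)]
  · simp [Fin.prod_univ_two, mul_assoc]
  · intro k _ hk
    rw [if_neg hk.symm]
    simp
  · intro h
    exact absurd (Finset.mem_range.2 (Nat.lt_succ_of_le h1)) h

theorem conjReflect_wCoeff (hn : p.degreeOf 0 ≤ n) (k : ℕ) :
    conjReflect n (wCoeff p k) =
      ∑ s ∈ p.support, if s 1 = k then C (conj (p.coeff s)) * X ^ (n - s 0) else 0 := by
  ext l
  simp only [conjReflect, coeff_reflect, coeff_map, wCoeff, finsetSum_coeff, map_sum]
  refine Finset.sum_congr rfl fun s hs => ?_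
  have h0 : s 0 ≤ n := MvPolynomial.degreeOf_le_iff.1 hn s hs
  split_ifs
  · rw [← revAt_le h0, ← reflect_C_mul_X_pow, coeff_reflect, coeff_C_mul_X_pow, coeff_C_mul_X_pow]
    split_ifs <;> simp
  · simp

theorem sum_eval_reflectSeq_mul_pow (hn : p.degreeOf 0 ≤ n) (hm : p.degreeOf 1 ≤ m) (z w : ℂ) :
    ∑ k ∈ Finset.range (m + 1), (reflectSeq n m (wCoeff p) k).eval z * w ^ k =
      evalAt (reflection n m p) z w := by
  unfold evalAt reflection
  simp only [reflectSeq, conjReflect_wCoeff hn, eval_finsetSum, Finset.sum_mul, map_sum, map_mul,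
    map_pow, MvPolynomial.eval_C, MvPolynomial.eval_X]
  rw [Finset.sum_comm]
  refine Finset.sum_congr rfl fun s hs => ?_
  have h1 : s 1 ≤ m := MvPolynomial.degreeOf_le_iff.1 hm s hs
  rw [Finset.sum_eq_single (m - s 1)]
  · rw [if_pos (Nat.sub_sub_self h1).symm]
    simp [mul_assoc]
  · intro k hk hne
    have := Finset.mem_range.1 hk
    rw [if_neg (by omega)]
    simp
  · intro h
    exact absurd (Finset.mem_range.2 (by omega)) h

theorem sliceAtZero_eq_wCoeff : sliceAtZero p = wCoeff p 0 := by
  rw [sliceAtZero, MvPolynomial.aeval_def, MvPolynomial.eval₂_eq', wCoeff]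
  refine Finset.sum_congr rfl fun s _ => ?_
  rw [Fin.prod_univ_two]
  split_ifs with h
  · simp [h]
  · simp [zero_pow h]

theorem exists_mvPolynomial_evalAt {σ : Type*} [Fintype σ] (b : σ → ℂ) (e f : σ → ℕ) :
    ∃ q : MvPolynomial (Fin 2) ℂ, ∀ z w, evalAt q z w = b ⬝ᵥ fun x => z ^ e x * w ^ f x := by
  refine ⟨∑ x, MvPolynomial.C (b x) * (MvPolynomial.X 0 ^ e x * MvPolynomial.X 1 ^ f x),
    fun z w => ?_⟩
  simp [evalAt, dotProduct]

end

theorem mainTheorem2 (p : MvPolynomial (Fin 2) ℂ) (n m : ℕ) (hdeg : HasBidegree p n m)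
    (hp : NoZerosCircleClosedDisk p ∨
      (NoZerosCircleDisk p ∧ IsRelPrime p (reflection n m p))) :
    ∃ n₁ n₂ : ℕ, n₂ = numDiskZeros (sliceAtZero p) ∧ n₁ + n₂ = n ∧
      ∃ (A : Fin m → MvPolynomial (Fin 2) ℂ) (B : Fin n₁ → MvPolynomial (Fin 2) ℂ)
        (C : Fin n₂ → MvPolynomial (Fin 2) ℂ),
        ∀ z w : ℂ,
          ‖evalAt p z w‖ ^ 2 - ‖evalAt (reflection n m p) z w‖ ^ 2 =
            (1 - ‖w‖ ^ 2) * ∑ j, ‖evalAt (A j) z w‖ ^ 2 +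
              (1 - ‖z‖ ^ 2) *
                (∑ j, ‖evalAt (B j) z w‖ ^ 2 - ∑ j, ‖evalAt (C j) z w‖ ^ 2) := by
  have hp' : NoZerosCircleDisk p := hp.elim (fun h z w hz hw => h z w hz hw.le) And.left
  have hn := hdeg.1.le
  have hm := hdeg.2.le
  have hP : ∀ k, (wCoeff p k).natDegree ≤ n := natDegree_wCoeff_le hn
  obtain ⟨n₁, a, hn₁, hiso, hi₁, hi₂⟩ := exists_factor_indexLE (m := m) hP fun z w hz hw => by
    rw [sum_eval_wCoeff_mul_pow hm]
    exact hp' z w hz hw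
  rw [sliceAtZero_eq_wCoeff]
  refine ⟨n₁, _, rfl, hn₁, ?_⟩
  obtain ⟨B, C, hBC⟩ := hi₁.exists_sum_sq_sub_sum_sq hi₂
  choose A' hA' using fun j : Fin m => exists_mvPolynomial_evalAt
    (fun x : Fin (n + 1) × Fin m => a x.1 j x.2) (fun x => x.1) fun x => x.2
  choose B' hB' using fun j => exists_mvPolynomial_evalAt (B j) (fun x => x.1) fun x => x.2
  choose C' hC' using fun j => exists_mvPolynomial_evalAt (C j) (fun x => x.1) fun x => x.2
  refine ⟨A', B', C', fun z w => ?_⟩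
  have key := sum_sq_norm_eval_sub_eq hiso
    (natDegree_borderRight_le (natDegree_reflectSeq_le hP) a) (natDegree_borderLeft_le hP a) z
    fun c : Fin (m + 1) => w ^ (c : ℕ)
  have hA : ∀ j, ∑ k : Fin m, (toPoly a j k).eval z * w ^ (k : ℕ) = evalAt (A' j) z w := by
    intro j
    rw [hA', dotProduct, Fintype.sum_prod_type_right]
    refine Finset.sum_congr rfl fun k _ => ?_
    simp only [toPoly, eval_finsetSum, eval_mul, eval_C, eval_pow, eval_X, Finset.sum_mul]
    exact Finset.sum_congr rfl fun l _ => mul_assoc _ _ _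
  have hL : ∑ i, ‖∑ c : Fin (m + 1),
      (borderLeft (wCoeff p) (toPoly a) i c).eval z * w ^ (c : ℕ)‖ ^ 2 =
      ‖evalAt p z w‖ ^ 2 + ‖w‖ ^ 2 * ∑ j, ‖evalAt (A' j) z w‖ ^ 2 := by
    refine (Fin.sum_univ_succ _).trans ?_
    congr 1
    · rw [← sum_eval_wCoeff_mul_pow hm, Finset.sum_range]
      rfl
    · rw [Finset.mul_sum]
      refine Finset.sum_congr rfl fun j _ => ?_
      rw [Fin.sum_univ_succ, ← hA, ← mul_pow, ← norm_mul, Finset.mul_sum]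
      simp only [borderLeft_succ_zero, borderLeft_succ_succ, eval_zero, zero_mul, zero_add,
        Fin.val_succ, pow_succ' w]
      exact congrArg (fun t : ℂ => ‖t‖ ^ 2) (Finset.sum_congr rfl fun k _ => mul_left_comm _ _ _)
  have hR : ∑ i, ‖∑ c : Fin (m + 1),
      (borderRight (reflectSeq n m (wCoeff p)) (toPoly a) i c).eval z * w ^ (c : ℕ)‖ ^ 2 =
      ‖evalAt (reflection n m p) z w‖ ^ 2 + ∑ j, ‖evalAt (A' j) z w‖ ^ 2 := by
    refine (Fin.sum_univ_succ _).trans ?_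
    congr 1
    · rw [← sum_eval_reflectSeq_mul_pow hn hm, Finset.sum_range]
      rfl
    · refine Finset.sum_congr rfl fun j _ => ?_
      rw [Fin.sum_univ_castSucc, ← hA]
      simp only [borderRight_succ_last, borderRight_succ_castSucc, eval_zero, zero_mul, add_zero,
        Fin.val_castSucc]
  rw [hL, hR, hBC] at key
  simp only [hB', hC']
  linarith
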